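/- Let $\mathcal M$ be a von Neumann algebra with a normal semifinite faithful trace $\tau$. Let $\mathcal S(\mathcal M)$ be the linear span of the positive $x\in\mathcal M$ whose support projection $s(x)$ satisfies $\tau(s(x))<\infty$, and for $1\le p<\infty$ let $L_p(\mathcal M)$ be the completion of $\mathcal S(\mathcal M)$ for the norm $\|x\|_{L_p(\mathcal M)}=\tau(|x|^p)^{1/p}$. Let $d\ge 1$ and $\mathcal N=L_\infty(\mathbb R^d)\,\overline\otimes\,\mathcal M$ with the tensor trace $\int_{\mathbb R^d}dx\otimes\tau$, and identify $L_p(\mathcal N)$ with the Bochner space $L_p(\mathbb R^d;L_p(\mathcal M))$. For $1<p<\infty$ and $1\le j\le d$, the $j$-th Riesz transform of $f\in L_p(\mathcal N)$ is $$R_jf=\lim_{\varepsilon\to0^+}R_j^\varepsilon f\ \text{ in } L_p(\mathcal N),\qquad R_j^{\varepsilon}f(x)=\frac{\Gamma(\frac{d+1}{2})}{\pi^{\frac{d+1}{2}}}\int_{|x-y|>\varepsilon}\frac{x_j-y_j}{|x-y|^{d+1}}\,f(y)\,dy .$$ Let $\mathcal S(\mathbb R^d)\otimes\mathcal S(\mathcal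 M)\subset L_p(\mathcal N)$ be the linear span of the functions $x\mapsto\varphi(x)m$, where $\varphi$ is a complex-valued Schwartz function on $\mathbb R^d$ and $m\in\mathcal S(\mathcal M)$. Lemma 3.3. Let $1<p<\infty$ and $1\le j\le d$. Then $R_j(L_p(\mathcal N))\cap(\mathcal S(\mathbb R^d)\otimes\mathcal S(\mathcal M))$ is dense in $L_p(\mathcal N)$. In particular, $R_j(L_p(\mathcal N))$ is dense in $L_p(\mathcal N)$. -/

import Mathlib

open MeasureTheory Filter Topology
open scoped ENNReal NNReal

noncomputable section

namespace SemiCommRiesz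

section Trace

variable {H : Type*} [NormedAddCommGroup H] [InnerProductSpace ℂ H] [CompleteSpace H]

/-- A normal semifinite faithful trace on the von Neumann algebra `M`: a map from the positive cone
of `M` to `[0, ∞]`. It is written as a function on all bounded operators, of which only the values
on positive elements of `M` carry any meaning. -/
structure NSFTrace (M : VonNeumannAlgebra H) where
  /-- The values of the trace. -/
  val : (H →L[ℂ] H) → ℝ≥0∞
  map_add : ∀ x ∈ M, ∀ y ∈ M, 0 ≤ x → 0 ≤ y → val (x + y) = val x + val y
  map_smul : ∀ (c : ℝ≥0), ∀ x ∈ M, 0 ≤ x → val (((c : ℝ) : ℂ) • x) = c * val x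
  tracial : ∀ x ∈ M, val (star x * x) = val (x * star x)
  /-- Normality: the trace preserves suprema of bounded increasing families. -/
  normal : ∀ D : Set (H →L[ℂ] H), D.Nonempty → DirectedOn (· ≤ ·) D →
    (∀ x ∈ D, x ∈ M ∧ 0 ≤ x) → ∀ a ∈ M, IsLUB D a → val a = ⨆ x ∈ D, val x
  semifinite : ∀ x ∈ M, 0 ≤ x → x ≠ 0 → ∃ y ∈ M, 0 ≤ y ∧ y ≤ x ∧ y ≠ 0 ∧ val y < ∞
  faithful : ∀ x ∈ M, 0 ≤ x → val x = 0 → x = 0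

/-- `e` is the support of `x` in `M`: the smallest projection `e` of `M` with `e x e = x`. -/
def IsSupport (M : VonNeumannAlgebra H) (x e : H →L[ℂ] H) : Prop :=
  IsLeast {q : H →L[ℂ] H | q ∈ M ∧ IsStarProjection q ∧ q * x * q = x} e

variable {M : VonNeumannAlgebra H}

/-- The linear span `𝒮(M)` of the positive elements of `M` whose support has finite trace. -/
def finSupp (τ : NSFTrace M) : Submodule ℂ (H →L[ℂ] H) :=
  Submodule.span ℂ {x | x ∈ M ∧ 0 ≤ x ∧ ∃ e, IsSupport M x e ∧ τ.val e < ∞}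

/-- `‖x‖_p = τ(|x|^p)^{1/p}`, where `|x| = (x⋆ x)^{1/2}`; it is finite on `𝒮(M)` for `1 ≤ p < ∞`. -/
def traceNorm (τ : NSFTrace M) (p : ℝ≥0∞) (x : H →L[ℂ] H) : ℝ :=
  (τ.val (CFC.abs x ^ p.toReal)).toReal ^ (1 / p.toReal)

/-- The norm `‖·‖_p` on `𝒮(M)`, bundled as a seminorm, namely as the largest seminorm that is
bounded by `x ↦ τ(|x|^p)^{1/p}`. For `1 ≤ p < ∞` the latter function is itself a norm (this is the
noncommutative Minkowski inequality), so the two are equal; see `lpSeminorm_apply`. -/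
def lpSeminorm (τ : NSFTrace M) (p : ℝ≥0∞) : Seminorm ℂ (finSupp τ) :=
  sSup {q | ∀ x, q x ≤ traceNorm τ p (x : H →L[ℂ] H)}

/-- As soon as `τ(|x|^p)^{1/p}` is given by some seminorm `q`, that seminorm is `lpSeminorm`. -/
theorem lpSeminorm_apply (τ : NSFTrace M) (p : ℝ≥0∞) (q : Seminorm ℂ (finSupp τ))
    (hq : ∀ x, q x = traceNorm τ p (x : H →L[ℂ] H)) (x : finSupp τ) :
    lpSeminorm τ p x = traceNorm τ p (x : H →L[ℂ] H) := by
  have h : lpSeminorm τ p = q := by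
    have hg : IsGreatest {r : Seminorm ℂ (finSupp τ) |
        ∀ x, r x ≤ traceNorm τ p (x : H →L[ℂ] H)} q :=
      ⟨fun x => (hq x).le, fun r hr x => (hr x).trans (hq x).ge⟩
    exact hg.csSup_eq
  rw [h, hq]

/-- `𝒮(M)` regarded as a space normed by `‖·‖_p`. -/
def FinSuppLp (τ : NSFTrace M) (_p : ℝ≥0∞) : Type _ := finSupp τ

instance (τ : NSFTrace M) (p : ℝ≥0∞) : AddCommGroup (FinSuppLp τ p) :=
  inferInstanceAs (AddCommGroup (finSupp τ))

instance (τ : NSFTrace M) (p : ℝ≥0∞) : Module ℂ (FinSuppLp τ p) :=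
  inferInstanceAs (Module ℂ (finSupp τ))

instance (τ : NSFTrace M) (p : ℝ≥0∞) : SeminormedAddCommGroup (FinSuppLp τ p) :=
  (show Seminorm ℂ (FinSuppLp τ p) from
    lpSeminorm τ p).toAddGroupSeminorm.toSeminormedAddCommGroup

instance (τ : NSFTrace M) (p : ℝ≥0∞) : NormedSpace ℂ (FinSuppLp τ p) where
  norm_smul_le c x := (map_smul_eq_mul (lpSeminorm τ p) c x).le

/-- The noncommutative space `L_p(M)`: the completion of `(𝒮(M), ‖·‖_p)`. -/
abbrev NCLp (τ : NSFTrace M) (p : ℝ≥0∞) : Type _ := UniformSpace.Completion (FinSuppLp τ p)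

/-- The canonical map `𝒮(M) → L_p(M)`. -/
def toNCLp (τ : NSFTrace M) (p : ℝ≥0∞) (m : finSupp τ) : NCLp τ p :=
  ((show FinSuppLp τ p from m : FinSuppLp τ p) : UniformSpace.Completion (FinSuppLp τ p))

end Trace

section Riesz

variable {d : ℕ} {E : Type*} [NormedAddCommGroup E] [NormedSpace ℂ E]

/-- The `j`-th Riesz kernel `Γ((d+1)/2) / π^{(d+1)/2} * z_j / |z|^{d+1}` on `ℝ^d`. -/
def rieszKernel (j : Fin d) (z : EuclideanSpace ℝ (Fin d)) : ℝ :=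
  Real.Gamma (((d : ℝ) + 1) / 2) / Real.pi ^ (((d : ℝ) + 1) / 2) * (z j / ‖z‖ ^ (d + 1))

/-- The `j`-th truncated Riesz transform `∫_{|x - y| > ε} K_j(x - y) f(y) dy`. For `f` in `L_p`,
`1 ≤ p < ∞`, and `ε > 0` the integral converges absolutely. -/
def truncRiesz (j : Fin d) (ε : ℝ) (f : EuclideanSpace ℝ (Fin d) → E)
    (x : EuclideanSpace ℝ (Fin d)) : E :=
  ∫ y in {y | ε < ‖x - y‖}, ((rieszKernel j (x - y) : ℝ) : ℂ) • f y

/-- `g = R_j f` in `L_p(ℝ^d; E)`: the truncated Riesz transforms of `f` converge to `g` in `L_p` as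
the truncation parameter tends to `0`. -/
def IsRieszTransform (j : Fin d) {p : ℝ≥0∞}
    (f g : Lp E p (volume : Measure (EuclideanSpace ℝ (Fin d)))) : Prop :=
  Tendsto (fun ε : ℝ => eLpNorm (fun x => truncRiesz j ε f x - g x) p volume) (𝓝[>] 0) (𝓝 0)

/-- The range `R_j(L_p(ℝ^d; E))`. -/
def rieszRange (E : Type*) [NormedAddCommGroup E] [NormedSpace ℂ E] (p : ℝ≥0∞) (j : Fin d) :
    Set (Lp E p (volume : Measure (EuclideanSpace ℝ (Fin d)))) :=
  {g | ∃ f, IsRieszTransform j f g}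

end Riesz

section SemiCommutative

variable {H : Type*} [NormedAddCommGroup H] [InnerProductSpace ℂ H] [CompleteSpace H]
  {M : VonNeumannAlgebra H}

/-- The semi-commutative space `L_p(L_∞(ℝ^d) ⊗̄ M) = L_p(ℝ^d; L_p(M))` of Bochner `p`-integrable
functions. -/
abbrev SemiLp (d : ℕ) (τ : NSFTrace M) (p : ℝ≥0∞) : Type _ :=
  Lp (NCLp τ p) p (volume : Measure (EuclideanSpace ℝ (Fin d)))

/-- `𝒮(ℝ^d) ⊗ 𝒮(M)` inside `L_p(ℝ^d; L_p(M))`: the linear span of the elementary tensors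
`x ↦ φ(x) m` with `φ` a complex Schwartz function and `m ∈ 𝒮(M)`. -/
def schwartzTensor (d : ℕ) (τ : NSFTrace M) (p : ℝ≥0∞) : Submodule ℂ (SemiLp d τ p) :=
  Submodule.span ℂ {g | ∃ (φ : SchwartzMap (EuclideanSpace ℝ (Fin d)) ℂ) (m : finSupp τ),
    g =ᵐ[volume] fun x => φ x • toNCLp τ p m}

end SemiCommutative

end SemiCommRiesz

end

/-! The problem is scalar. On Schwartz functions `R_j` is the Fourier multiplier with symbol `-i
ξ_j/|ξ|`, which can be inverted smoothly away from the hyperplane `ξ_j = 0`. Let `φ` have compactly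
supported Fourier transform, let `χ` be a bump equal to 1 near 0, and let `u_n` have Fourier
transform `χ(n ξ_j) φ̂`. Then `i (|ξ|/ξ_j) (1 - χ(n ξ_j)) φ̂` is smooth with compact support, so it
is `f̂` for a Schwartz function `f`, and `R_j f = φ - u_n`. Such `φ` are dense, so it remains to see
that `u_n → 0` in `L_p`.

This is `tendsto_eLpNorm_multiplier`. Since `u_n` is an average of translates of `φ` against a fixed
integrable weight, its `L_1` norm is bounded in `n`. Its sup norm is at most the `L_1` norm of
`û_n`, which tends to 0 by dominated convergence because the hyperplane is null. Interpolating
between the two bounds gives `L_p` convergence exactly because `p > 1`. The same lemma, with dilated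
cut-offs tending to 1, gives the density of band-limited functions.

The symbol is computed in `rieszPV_eq_integral_fourier` by writing the kernel as a superposition
over `t` of the functions `z_j exp(-t|z|²)` and applying Fubini twice. The truncations of a Schwartz
function converge in `L_p` by a direct estimate, so no boundedness of `R_j` on `L_p` is needed,
neither for scalar nor for vector values. Passing to values in `L_p(M)` uses only that truncations
commute with `f ↦ f ⊗ m`, together with the density of elementary tensors. -/

noncomputable section

/-! ### Density of elementary tensors in Bochner spaces. -/

/-- Elementary tensors `u ⊗ m` with `u` in a dense subset of scalar `L_p` and `m` in a dense subset
of `E` have dense linear span in `L_p(E)`. -/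
theorem dense_span_toSpanSingleton_compLp {α E : Type*} [MeasurableSpace α] {μ : Measure α}
    [NormedAddCommGroup E] [NormedSpace ℂ E] {p : ℝ≥0∞} [Fact (1 ≤ p)] (hp : p ≠ ∞)
    {D : Set (Lp ℂ p μ)} (hD : Dense D) {S : Set E} (hS : Dense S) :
    Dense (Submodule.span ℂ {g : Lp E p μ | ∃ u ∈ D, ∃ m ∈ S,
      g = (ContinuousLinearMap.toSpanSingleton ℂ m).compLp u} : Set (Lp E p μ)) := by
  set T := Submodule.span ℂ {g : Lp E p μ | ∃ u ∈ D, ∃ m ∈ S,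
    g = (ContinuousLinearMap.toSpanSingleton ℂ m).compLp u} with hT
  have h1 : ∀ m ∈ S, ∀ u : Lp ℂ p μ,
      (ContinuousLinearMap.toSpanSingleton ℂ m).compLp u ∈ T.topologicalClosure := by
    intro m hm u
    have hcl : IsClosed {u : Lp ℂ p μ |
        (ContinuousLinearMap.toSpanSingleton ℂ m).compLp u ∈ T.topologicalClosure} :=
      T.isClosed_topologicalClosure.preimage
        ((ContinuousLinearMap.toSpanSingleton ℂ m).compLpL p μ).continuous
    refine hcl.closure_subset_iff.2 ?_ (hD u)
    intro v hv
    exact T.le_topologicalClosure (Submodule.subset_span ⟨v, hv, m, hm, rfl⟩)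
  have h2 : ∀ (c : E) {s : Set α} (hs : MeasurableSet s) (hμs : μ s ≠ ∞),
      indicatorConstLp p hs hμs c ∈ T.topologicalClosure := by
    intro c s hs hμs
    -- The map is Lipschitz with constant `μ(s)^(1/p)`, so membership in the closed span passes from
    -- values in `S` to all values; indicators then suffice by `Lp.induction`.
    have hcont : Continuous fun c : E => indicatorConstLp p hs hμs c := by
      refine LipschitzWith.continuous (K := (μ.real s ^ (1 / p.toReal)).toNNReal)
        (LipschitzWith.of_dist_le_mul fun x y => ?_)
      rw [dist_eq_norm, dist_eq_norm, indicatorConstLp_sub,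
        Real.coe_toNNReal _ (by positivity), mul_comm]
      exact norm_indicatorConstLp_le
    have hcl : IsClosed {c : E | indicatorConstLp p hs hμs c ∈ T.topologicalClosure} :=
      T.isClosed_topologicalClosure.preimage hcont
    refine hcl.closure_subset_iff.2 ?_ (hS c)
    intro m hm
    have := h1 m hm (indicatorConstLp p hs hμs 1)
    have heq : indicatorConstLp p hs hμs m =
        (ContinuousLinearMap.toSpanSingleton ℂ m).compLp (indicatorConstLp p hs hμs 1) := by
      ext1
      refine indicatorConstLp_coeFn.trans ?_
      refine EventuallyEq.trans ?_ (EventuallyEq.symm (ContinuousLinearMap.coeFn_compLp _ _))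
      refine (indicatorConstLp_coeFn (p := p) (hs := hs) (hμs := hμs) (c := (1 : ℂ))).mono
        fun y hy => ?_
      dsimp only
      rw [hy]
      by_cases hys : y ∈ s <;> simp [hys]
    rwa [Set.mem_ofPred_eq, heq]
  rw [Submodule.dense_iff_topologicalClosure_eq_top, eq_top_iff]
  intro f _
  refine Lp.induction hp (fun f => f ∈ T.topologicalClosure) ?_ ?_ T.isClosed_topologicalClosure f
  · intro c s hs hμs
    simpa using h2 c hs hμs.ne
  · intro f g hf hg _ hf' hg'
    exact T.topologicalClosure.add_mem hf' hg'

/-! ### Kernel estimates and convergence of truncations on Schwartz functions. -/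

namespace SemiCommRiesz
open scoped SchwartzMap

variable {d : ℕ} (j : Fin d)

local notation "V" => EuclideanSpace ℝ (Fin d)

/-- The normalising constant of the Riesz kernels. -/
def rieszConst (d : ℕ) : ℝ := Real.Gamma (((d : ℝ) + 1) / 2) / Real.pi ^ (((d : ℝ) + 1) / 2)

theorem rieszConst_pos (d : ℕ) : 0 < rieszConst d := by
  unfold rieszConst
  have := Real.Gamma_pos_of_pos (s := ((d : ℝ) + 1) / 2) (by positivity)
  have := Real.pi_pos
  positivity

theorem rieszKernel_eq (z : V) : rieszKernel j z = rieszConst d * (z j / ‖z‖ ^ (d + 1)) := rfl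

theorem rieszKernel_neg (z : V) : rieszKernel j (-z) = -rieszKernel j z := by
  simp [rieszKernel_eq, neg_div]

theorem measurable_rieszKernel : Measurable (rieszKernel j : V → ℝ) := by
  have : Measurable fun z : V => z j := (EuclideanSpace.proj (𝕜 := ℝ) j).continuous.measurable
  unfold rieszKernel
  fun_prop

theorem abs_rieszKernel_le (z : V) : |rieszKernel j z| ≤ rieszConst d * (‖z‖ ^ d)⁻¹ := by
  have hc := rieszConst_pos d
  rw [rieszKernel_eq, abs_mul, abs_of_pos hc]
  refine mul_le_mul_of_nonneg_left ?_ hc.le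
  rcases eq_or_ne z 0 with rfl | hz
  · simp
  · have h0 : 0 < ‖z‖ := norm_pos_iff.2 hz
    rw [abs_div, abs_of_nonneg (by positivity : 0 ≤ ‖z‖ ^ (d + 1)), div_le_iff₀ (by positivity),
      pow_succ, inv_mul_cancel_left₀ (by positivity)]
    exact PiLp.norm_apply_le z j

/-- In polar coordinates the majorant `|z|^(1-d)` exactly cancels the Jacobian `r^(d-1)`. The extra
factor `‖z‖` is what the difference `f (x - z) - f (x + z)` supplies near the origin. -/
theorem integrableOn_norm_mul_rieszKernel :
    IntegrableOn (fun z : V => ‖z‖ * |rieszKernel j z|) (Metric.ball 0 2) := by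
  have hd : 0 < d := j.pos
  have : Nonempty (Fin d) := ⟨j⟩
  have h1 : IntegrableOn (fun z : V => ‖z‖ * (rieszConst d * (‖z‖ ^ d)⁻¹)) (Metric.ball 0 2) := by
    rw [integrableOn_fun_norm_addHaar (μ := (volume : Measure V))
      (f := fun r => r * (rieszConst d * (r ^ d)⁻¹))]
    have : IntegrableOn (fun _ : ℝ => rieszConst d) (Set.Ioo 0 2) := by
      simp
    refine this.congr_fun ?_ measurableSet_Ioo
    intro y hy
    have hy0 : y ≠ 0 := hy.1.ne'
    obtain ⟨n, rfl⟩ : ∃ n, d = n + 1 := ⟨d - 1, by omega⟩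
    simp
    field_simp
    ring
  refine h1.mono' ?_ ?_
  · exact (measurable_norm.mul (measurable_rieszKernel j).abs).aestronglyMeasurable
  · refine ae_of_all _ fun z => ?_
    rw [Real.norm_of_nonneg (by positivity)]
    exact mul_le_mul_of_nonneg_left (abs_rieszKernel_le j z) (norm_nonneg _)

/-- Mean value inequality on the unit ball around `x`, where the weights `1 + ‖w‖` and `1 + ‖x‖` are
comparable. The decay in `x` later makes the truncation error `p`-integrable. -/
theorem exists_norm_sub_le_of_schwartz {E : Type*} [NormedAddCommGroup E] [NormedSpace ℝ E]
    (f : 𝓢(E, ℂ)) (k : ℕ) : ∃ C, 0 ≤ C ∧ ∀ x z : E, ‖z‖ ≤ 1 →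
      ‖f (x - z) - f (x + z)‖ ≤ C * ((1 + ‖x‖) ^ k)⁻¹ * ‖z‖ := by
  set S := 2 ^ k * (Finset.Iic (k, 1)).sup (fun m => SchwartzMap.seminorm ℝ m.1 m.2) f with hS
  have hS0 : 0 ≤ S := by positivity
  have hder : ∀ w, (1 + ‖w‖) ^ k * ‖fderiv ℝ f w‖ ≤ S := by
    intro w
    have := SchwartzMap.one_add_le_sup_seminorm_apply (𝕜 := ℝ) (m := (k, 1)) le_rfl le_rfl f w
    rwa [norm_iteratedFDeriv_one] at this
  -- A factor `2 ^ k` comes from comparing the weights, and one more `2` from the distance `2‖z‖`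
  -- between `x - z` and `x + z`.
  refine ⟨2 ^ (k + 1) * S, by positivity, fun x z hz => ?_⟩
  have hb : ∀ w ∈ Metric.closedBall x 1, ‖fderiv ℝ f w‖ ≤ 2 ^ k * S * ((1 + ‖x‖) ^ k)⁻¹ := by
    intro w hw
    have hxw : 1 + ‖x‖ ≤ 2 * (1 + ‖w‖) := by
      have h1 : ‖x‖ ≤ ‖w‖ + ‖x - w‖ := by simpa using norm_add_le w (x - w)
      have h2 : ‖x - w‖ ≤ 1 := by simpa [dist_eq_norm, norm_sub_rev] using hw
      have := norm_nonneg w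
      linarith
    rw [← div_eq_mul_inv, le_div_iff₀ (by positivity)]
    calc ‖fderiv ℝ f w‖ * (1 + ‖x‖) ^ k ≤ ‖fderiv ℝ f w‖ * (2 * (1 + ‖w‖)) ^ k := by gcongr
      _ = 2 ^ k * ((1 + ‖w‖) ^ k * ‖fderiv ℝ f w‖) := by rw [mul_pow]; ring
      _ ≤ 2 ^ k * S := by gcongr; exact hder w
  have := (convex_closedBall x 1).norm_image_sub_le_of_norm_fderiv_le (𝕜 := ℝ) (f := f)
    (x := x + z) (y := x - z) (fun w _ => f.differentiableAt) hb (by simpa) (by simpa [dist_eq_norm])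
  refine this.trans (le_of_eq ?_)
  have : x - z - (x + z) = (-2 : ℝ) • z := by module
  rw [this, norm_smul]
  norm_num
  ring

/-- The Riesz transform of a Schwartz function, written as an absolutely convergent integral. -/
def rieszPV (f : 𝓢(V, ℂ)) (x : V) : ℂ :=
  (1 / 2 : ℂ) * ∫ z, (rieszKernel j z : ℂ) * (f (x - z) - f (x + z))

theorem integrable_sub_left_schwartz (f : 𝓢(V, ℂ)) (x : V) : Integrable fun z => f (x - z) :=
  f.integrable.comp_sub_left x

theorem integrable_add_left_schwartz (f : 𝓢(V, ℂ)) (x : V) : Integrable fun z => f (x + z) :=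
  f.integrable.comp_add_left x

theorem integrableOn_rieszKernel_mul {ε : ℝ} (hε : 0 < ε) {g : V → ℂ} (hg : Integrable g) :
    IntegrableOn (fun z => (rieszKernel j z : ℂ) * g z) {z | ε < ‖z‖} := by
  have hms : MeasurableSet {z : V | ε < ‖z‖} := measurableSet_lt measurable_const measurable_norm
  have hc := rieszConst_pos d
  refine (hg.integrableOn (s := {z | ε < ‖z‖})).bdd_mul (c := rieszConst d * (ε ^ d)⁻¹) ?_ ?_
  · exact (Complex.measurable_ofReal.comp (measurable_rieszKernel j)).aestronglyMeasurable
  · refine (ae_restrict_iff' hms).2 (ae_of_all _ fun z hz => ?_)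
    simp only [Complex.norm_real, Real.norm_eq_abs]
    refine (abs_rieszKernel_le j z).trans ?_
    have : ε < ‖z‖ := hz
    gcongr

theorem integrable_rieszPV (f : 𝓢(V, ℂ)) (x : V) :
    Integrable fun z => (rieszKernel j z : ℂ) * (f (x - z) - f (x + z)) := by
  have hm := integrableOn_rieszKernel_mul j one_pos
    ((integrable_sub_left_schwartz f x).sub (integrable_add_left_schwartz f x))
  have hn : IntegrableOn (fun z => (rieszKernel j z : ℂ) * (f (x - z) - f (x + z)))
      {z | 1 < ‖z‖}ᶜ := by
    obtain ⟨C, hC, h⟩ := exists_norm_sub_le_of_schwartz f 0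
    have hsub : {z : V | 1 < ‖z‖}ᶜ ⊆ Metric.ball 0 2 := by
      intro z hz
      have hz' : ‖z‖ ≤ 1 := not_lt.1 hz
      simpa using hz'.trans_lt one_lt_two
    refine (((integrableOn_norm_mul_rieszKernel j).mono_set hsub).const_mul C).mono' ?_ ?_
    · refine Measurable.aestronglyMeasurable ?_
      refine (Complex.measurable_ofReal.comp (measurable_rieszKernel j)).mul ?_
      have := f.continuous
      exact Continuous.measurable (by fun_prop)
    · refine (ae_restrict_iff' (measurableSet_lt measurable_const measurable_norm).compl).2
        (ae_of_all _ fun z hz => ?_)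
      have hz' : ‖z‖ ≤ 1 := not_lt.1 hz
      have := h x z hz'
      simp only [pow_zero, inv_one, mul_one] at this
      rw [norm_mul, Complex.norm_real, Real.norm_eq_abs]
      calc |rieszKernel j z| * ‖f (x - z) - f (x + z)‖ ≤ |rieszKernel j z| * (C * ‖z‖) := by gcongr
        _ = _ := by ring
  simpa using hm.union hn

/-- The kernel is odd and the truncation region symmetric, so the integral equals its average with
its reflection under `z ↦ -z`. -/
theorem truncRiesz_eq {ε : ℝ} (hε : 0 < ε) (f : 𝓢(V, ℂ)) (x : V) :
    truncRiesz j ε f x =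
      (1 / 2 : ℂ) * ∫ z in {z | ε < ‖z‖}, (rieszKernel j z : ℂ) * (f (x - z) - f (x + z)) := by
  have hms : MeasurableSet {z : V | ε < ‖z‖} := measurableSet_lt measurable_const measurable_norm
  have hms' : MeasurableSet {y : V | ε < ‖x - y‖} :=
    measurableSet_lt measurable_const (by fun_prop)
  have h1 : truncRiesz j ε f x = ∫ z in {z | ε < ‖z‖}, (rieszKernel j z : ℂ) * f (x - z) := by
    unfold truncRiesz
    rw [← integral_indicator hms, ← integral_indicator hms',
      ← integral_sub_left_eq_self _ volume x]
    congr 1 with y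
    simp [Set.indicator]
  have h2 : truncRiesz j ε f x = -∫ z in {z | ε < ‖z‖}, (rieszKernel j z : ℂ) * f (x + z) := by
    rw [h1, ← integral_neg, ← integral_indicator hms, ← integral_indicator hms,
      ← integral_neg_eq_self]
    congr 1 with y
    simp [Set.indicator, rieszKernel_neg]
  have h3 : ∫ z in {z | ε < ‖z‖}, (rieszKernel j z : ℂ) * (f (x - z) - f (x + z)) =
      truncRiesz j ε f x + truncRiesz j ε f x := by
    nth_rw 2 [h2]
    rw [h1, ← sub_eq_add_neg, ← integral_sub
      (integrableOn_rieszKernel_mul j hε (integrable_sub_left_schwartz f x))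
      (integrableOn_rieszKernel_mul j hε (integrable_add_left_schwartz f x))]
    simp_rw [mul_sub]
  rw [h3]
  ring

theorem tendsto_integral_norm_mul_rieszKernel :
    Tendsto (fun ε : ℝ => ∫ z in {z : V | ‖z‖ ≤ ε}, ‖z‖ * |rieszKernel j z|) (𝓝[>] 0) (𝓝 0) := by
  have hms : ∀ ε : ℝ, MeasurableSet {z : V | ‖z‖ ≤ ε} := fun ε =>
    measurableSet_le measurable_norm measurable_const
  have hmeas : Measurable fun z : V => ‖z‖ * |rieszKernel j z| :=
    measurable_norm.mul (measurable_rieszKernel j).abs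
  have hint := integrableOn_norm_mul_rieszKernel j
  rw [← integrable_indicator_iff measurableSet_ball] at hint
  have key : Tendsto (fun ε : ℝ => ∫ z : V, Set.indicator {z : V | ‖z‖ ≤ ε}
      (fun z => ‖z‖ * |rieszKernel j z|) z) (𝓝[>] 0) (𝓝 (∫ _ : V, (0 : ℝ))) := by
    refine tendsto_integral_filter_of_dominated_convergence _ ?_ ?_ hint ?_
    · exact Eventually.of_forall fun ε => (hmeas.indicator (hms ε)).aestronglyMeasurable
    · filter_upwards [Ioo_mem_nhdsGT (zero_lt_one' ℝ)] with ε hε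
      refine ae_of_all _ fun z => ?_
      rw [norm_indicator_eq_indicator_norm]
      refine (Set.indicator_le_indicator_of_subset (t := Metric.ball 0 2) ?_
        (fun _ => norm_nonneg _) z).trans (le_of_eq ?_)
      · intro z hz
        have hz' : ‖z‖ ≤ ε := hz
        have := hε.2
        simp only [Metric.mem_ball, dist_zero_right]
        linarith
      · simp [Set.indicator]
    · refine ae_of_all _ fun z => ?_
      rcases eq_or_ne z 0 with rfl | hz
      · refine tendsto_const_nhds.congr fun ε => ?_
        simp [Set.indicator]
      · have h0 : 0 < ‖z‖ := norm_pos_iff.2 hz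
        refine tendsto_const_nhds.congr' ?_
        filter_upwards [Ioo_mem_nhdsGT h0] with ε hε
        rw [Set.indicator_of_notMem]
        simpa using hε.2
  simp only [integral_zero] at key
  refine key.congr fun ε => ?_
  rw [integral_indicator (hms ε)]

/-- The truncated Riesz transforms of a Schwartz function converge in `L_p`. -/
theorem tendsto_eLpNorm_truncRiesz (f : 𝓢(V, ℂ)) (p : ℝ≥0∞) :
    Tendsto (fun ε : ℝ => eLpNorm (fun x => truncRiesz j ε f x - rieszPV j f x) p volume)
      (𝓝[>] 0) (𝓝 0) := by
  -- The order `k` is chosen so that `(1 + ‖x‖)^(-k)` lies in `L_p`; the truncation error is then at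
  -- most `δ ε` times this fixed weight, with `δ ε → 0`.
  obtain ⟨k, hk⟩ := Measure.HasTemperateGrowth.exists_eLpNorm_lt_top p
    (inferInstance : (volume : Measure V).HasTemperateGrowth)
  obtain ⟨C, hC, hf⟩ := exists_norm_sub_le_of_schwartz f k
  set w : V → ℝ := fun x => (1 + ‖x‖) ^ (-k : ℝ) with hw
  set δ : ℝ → ℝ := fun ε => C / 2 * ∫ z in {z : V | ‖z‖ ≤ ε}, ‖z‖ * |rieszKernel j z| with hδ
  have hδ0 : Tendsto δ (𝓝[>] 0) (𝓝 0) := by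
    simpa using (tendsto_integral_norm_mul_rieszKernel j).const_mul (C / 2)
  have hbound : ∀ ε ∈ Set.Ioo (0 : ℝ) 1,
      ∀ x, ‖truncRiesz j ε f x - rieszPV j f x‖ ≤ δ ε * ‖w x‖ := by
    intro ε hε x
    have hms : MeasurableSet {z : V | ε < ‖z‖} := measurableSet_lt measurable_const measurable_norm
    have hcompl : {z : V | ε < ‖z‖}ᶜ = {z : V | ‖z‖ ≤ ε} := by ext z; simp
    have hwx : ‖w x‖ = ((1 + ‖x‖) ^ k)⁻¹ := by
      rw [hw]
      simp only
      rw [Real.rpow_neg (by positivity), Real.rpow_natCast, Real.norm_of_nonneg (by positivity)]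
    have hsplit := integral_add_compl hms (integrable_rieszPV j f x)
    rw [truncRiesz_eq j hε.1, rieszPV, ← hsplit, hcompl, ← mul_sub, sub_add_cancel_left, norm_mul,
      norm_neg]
    have hint : IntegrableOn (fun z : V => ‖z‖ * |rieszKernel j z|) {z : V | ‖z‖ ≤ ε} := by
      refine (integrableOn_norm_mul_rieszKernel j).mono_set fun z hz => ?_
      have hz' : ‖z‖ ≤ ε := hz
      have := hε.2
      simp only [Metric.mem_ball, dist_zero_right]
      linarith
    have : ‖∫ z in {z : V | ‖z‖ ≤ ε}, (rieszKernel j z : ℂ) * (f (x - z) - f (x + z))‖ ≤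
        ∫ z in {z : V | ‖z‖ ≤ ε}, C * ‖w x‖ * (‖z‖ * |rieszKernel j z|) := by
      refine norm_integral_le_of_norm_le (hint.const_mul _) ?_
      refine (ae_restrict_iff' (measurableSet_le measurable_norm measurable_const)).2
        (ae_of_all _ fun z hz => ?_)
      have hz' : ‖z‖ ≤ ε := hz
      have := hf x z (hz'.trans hε.2.le)
      rw [norm_mul, Complex.norm_real, Real.norm_eq_abs, hwx]
      calc |rieszKernel j z| * ‖f (x - z) - f (x + z)‖
          ≤ |rieszKernel j z| * (C * ((1 + ‖x‖) ^ k)⁻¹ * ‖z‖) := by gcongr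
        _ = _ := by ring
    rw [integral_const_mul] at this
    have h2 : ‖(1 / 2 : ℂ)‖ = 1 / 2 := by norm_num
    rw [h2, hδ]
    calc _ ≤ 1 / 2 * (C * ‖w x‖ * ∫ z in {z : V | ‖z‖ ≤ ε}, ‖z‖ * |rieszKernel j z|) := by gcongr
      _ = _ := by ring
  have hlim : Tendsto (fun ε => ENNReal.ofReal (δ ε) * eLpNorm w p volume) (𝓝[>] 0) (𝓝 0) := by
    have := ENNReal.Tendsto.mul_const (ENNReal.tendsto_ofReal hδ0) (Or.inr hk.ne)
    simpa using this
  refine tendsto_of_tendsto_of_tendsto_of_le_of_le' tendsto_const_nhds hlim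
    (Eventually.of_forall fun _ => zero_le) ?_
  filter_upwards [Ioo_mem_nhdsGT (zero_lt_one' ℝ)] with ε hε
  exact eLpNorm_le_mul_eLpNorm_of_ae_le_mul (ae_of_all _ (hbound ε hε)) p

end SemiCommRiesz

/-! ### Averages of translates, Gaussians and Gamma integrals. -/

namespace SemiCommRiesz
open scoped SchwartzMap FourierTransform RealInnerProductSpace

/-- The character `r ↦ exp(2πir)`. -/
def unitExp (r : ℝ) : ℂ := Complex.exp (((2 * Real.pi * r : ℝ) : ℂ) * Complex.I)

@[simp] theorem norm_unitExp (r : ℝ) : ‖unitExp r‖ = 1 := Complex.norm_exp_ofReal_mul_I _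

@[fun_prop] theorem continuous_unitExp : Continuous unitExp := by
  unfold unitExp
  fun_prop

theorem unitExp_add (r s : ℝ) : unitExp (r + s) = unitExp r * unitExp s := by
  unfold unitExp
  rw [← Complex.exp_add]
  push_cast
  ring_nf

section Averages

variable {U W : Type*} [NormedAddCommGroup U] [InnerProductSpace ℝ U] [FiniteDimensional ℝ U]
  [MeasurableSpace U] [BorelSpace U] [MeasurableSpace W] {μ : Measure W}

theorem schwartz_eq_integral_fourier (f : 𝓢(U, ℂ)) (x : U) :
    f x = ∫ ξ, unitExp ⟪x, ξ⟫ * (𝓕 f) ξ := by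
  have h : 𝓕⁻ (𝓕 f) = f := FourierTransform.fourierInv_fourier_eq f
  conv_lhs => rw [← h]
  rw [SchwartzMap.fourierInv_coe, Real.fourierInv_eq']
  simp_rw [smul_eq_mul, unitExp, real_inner_comm x]

/-- A weighted average of translates acts as a multiplier on the Fourier side. -/
theorem integral_mul_schwartz_sub [SFinite μ] {k : W → ℂ} (hk : Integrable k μ) {L : W → U}
    (hL : Measurable L) (f : 𝓢(U, ℂ)) (x : U) :
    ∫ t, k t * f (x - L t) ∂μ = ∫ ξ, unitExp ⟪x, ξ⟫ * (𝓕 f) ξ *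
      ∫ t, k t * unitExp (-⟪L t, ξ⟫) ∂μ := by
  have hphase : Measurable fun q : W × U => unitExp ⟪x - L q.1, q.2⟫ := by
    have h1 : Measurable fun q : W × U => ⟪x - L q.1, q.2⟫ :=
      (measurable_const.sub (hL.comp measurable_fst)).inner measurable_snd
    exact continuous_unitExp.measurable.comp h1
  have hint : Integrable (fun q : W × U =>
      unitExp ⟪x - L q.1, q.2⟫ * (k q.1 * (𝓕 f) q.2)) (μ.prod volume) :=
    (hk.mul_prod (𝓕 f).integrable).bdd_mul (c := 1) hphase.aestronglyMeasurable
      (ae_of_all _ fun q => by simp)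
  calc ∫ t, k t * f (x - L t) ∂μ
      = ∫ t, (∫ ξ, unitExp ⟪x - L t, ξ⟫ * (k t * (𝓕 f) ξ)) ∂μ := by
        congr 1 with t
        rw [schwartz_eq_integral_fourier f, ← integral_const_mul]
        congr 1 with ξ
        ring
    _ = ∫ ξ, ∫ t, unitExp ⟪x - L t, ξ⟫ * (k t * (𝓕 f) ξ) ∂μ :=
        integral_integral_swap hint
    _ = _ := by
        congr 1 with ξ
        rw [← integral_const_mul]
        congr 1 with t
        rw [inner_sub_left, sub_eq_add_neg, unitExp_add]
        ring

end Averages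

variable {d : ℕ} (j : Fin d)

local notation "V" => EuclideanSpace ℝ (Fin d)

theorem integrable_norm_mul_gaussian {t : ℝ} (ht : 0 < t) (hd : 0 < d) :
    Integrable fun z : V => ‖z‖ * Real.exp (-t * ‖z‖ ^ 2) := by
  have : Nonempty (Fin d) := ⟨⟨0, hd⟩⟩
  rw [integrable_fun_norm_addHaar (volume : Measure V) (f := fun r => r * Real.exp (-t * r ^ 2))]
  refine (integrableOn_rpow_mul_exp_neg_mul_sq ht (s := d)
    (by have := d.cast_nonneg (α := ℝ); linarith)).congr_fun ?_ measurableSet_Ioi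
  intro y _
  obtain ⟨n, rfl⟩ : ∃ n, d = n + 1 := ⟨d - 1, by omega⟩
  simp only [Real.rpow_natCast, finrank_euclideanSpace, Fintype.card_fin, smul_eq_mul,
    Nat.add_sub_cancel]
  ring

theorem integrable_coord_mul_gaussian {t : ℝ} (ht : 0 < t) :
    Integrable fun z : V => ((z j * Real.exp (-t * ‖z‖ ^ 2) : ℝ) : ℂ) := by
  have : Integrable fun z : V => z j * Real.exp (-t * ‖z‖ ^ 2) := by
    refine (integrable_norm_mul_gaussian ht j.pos).mono' ?_ (ae_of_all _ fun z => ?_)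
    · exact Continuous.aestronglyMeasurable (by fun_prop)
    · rw [norm_mul, Real.norm_of_nonneg (Real.exp_pos _).le]
      exact mul_le_mul_of_nonneg_right (PiLp.norm_apply_le z j) (Real.exp_pos _).le
  exact this.ofReal

/-- The Fourier transform of `z ↦ z_j exp(-t|z|²)`. -/
theorem integral_coord_mul_gaussian_fourierChar {t : ℝ} (ht : 0 < t) (ξ : V) :
    ∫ z : V, ((z j * Real.exp (-t * ‖z‖ ^ 2) : ℝ) : ℂ) * unitExp (-⟪z, ξ⟫) =
      -Complex.I * ((Real.pi * ξ j / t * (Real.pi / t) ^ ((d : ℝ) / 2) *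
        Real.exp (-(Real.pi * ‖ξ‖) ^ 2 / t) : ℝ) : ℂ) := by
  have htc : 0 < (t : ℂ).re := by simpa
  set G : V → ℂ := fun z => Complex.exp (-(t : ℂ) * ‖z‖ ^ 2) with hG
  have hGr : ∀ z, G z = (Real.exp (-t * ‖z‖ ^ 2) : ℂ) := fun z => by simp [hG]
  have hGn : ∀ z, ‖G z‖ = Real.exp (-t * ‖z‖ ^ 2) := fun z => by
    rw [hGr, Complex.norm_real, Real.norm_of_nonneg (Real.exp_pos _).le]
  have hGi : Integrable G := by
    simpa [hG] using GaussianFourier.integrable_cexp_neg_mul_sq_norm_add htc 0 (0 : V)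
  have hGi' : Integrable fun z : V => ‖z‖ * ‖G z‖ := by
    simp_rw [hGn]
    exact integrable_norm_mul_gaussian ht j.pos
  set c : ℝ := (Real.pi / t) ^ ((d : ℝ) / 2) with hc
  have hFG : 𝓕 G = fun w => ((c * Real.exp (-(Real.pi ^ 2 / t) * ‖w‖ ^ 2) : ℝ) : ℂ) := by
    funext w
    rw [hG, fourier_gaussian_innerProductSpace htc, hc]
    push_cast
    rw [Complex.ofReal_cpow (by positivity)]
    push_cast
    simp only [finrank_euclideanSpace, Fintype.card_fin]
    congr 2
    ring
  -- The derivative of `𝓕 G` is computed twice, under the integral sign and from the explicit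
  -- Gaussian; evaluating both in the direction `e_j` gives the formula.
  have h1 := Real.hasFDerivAt_fourier hGi hGi' ξ
  have h2 : HasFDerivAt (𝓕 G) (Complex.ofRealCLM.comp
      (c • (Real.exp (-(Real.pi ^ 2 / t) * ‖ξ‖ ^ 2) • (-(Real.pi ^ 2 / t)) •
        (2 • innerSL ℝ ξ)))) ξ := by
    rw [hFG]
    refine Complex.ofRealCLM.hasFDerivAt.comp ξ ?_
    exact (((hasStrictFDerivAt_norm_sq ξ).hasFDerivAt.const_mul _).exp).const_mul c
  have h3 := congrArg (fun A : V →L[ℝ] ℂ => A (EuclideanSpace.single j 1)) (h1.unique h2)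
  have hint : Integrable (VectorFourier.fourierSMulRight (innerSL ℝ) G) := by
    refine (hGi'.const_mul (2 * Real.pi * ‖innerSL ℝ (E := V)‖)).mono'
      hGi.aestronglyMeasurable.fourierSMulRight
      (ae_of_all _ fun v => ?_)
    refine (VectorFourier.norm_fourierSMulRight_le _ _ _).trans (le_of_eq ?_)
    ring
  simp only at h3
  rw [Real.fourier_continuousLinearMap_apply hint, Real.fourier_eq'] at h3
  simp only [VectorFourier.fourierSMulRight_apply, smul_eq_mul] at h3
  have h4 : ∀ v : V, Complex.exp (((-2 * Real.pi * ⟪v, ξ⟫ : ℝ) : ℂ) * Complex.I) *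
      (-(2 * Real.pi * Complex.I) * (innerSL ℝ v (EuclideanSpace.single j (1 : ℝ)) • G v)) =
      (-(2 * Real.pi * Complex.I)) *
        (((v j * Real.exp (-t * ‖v‖ ^ 2) : ℝ) : ℂ) * unitExp (-⟪v, ξ⟫)) := by
    intro v
    rw [hGr, unitExp, innerSL_apply_apply, EuclideanSpace.inner_single_right, Complex.real_smul,
      show 2 * Real.pi * -⟪v, ξ⟫ = -2 * Real.pi * ⟪v, ξ⟫ by ring]
    push_cast
    simp
    ring
  replace h3 := (integral_congr_ae (ae_of_all _ h4)).symm.trans h3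
  rw [integral_const_mul] at h3
  have h5 : -(2 * (Real.pi : ℂ) * Complex.I) ≠ 0 := by
    simp [Real.pi_ne_zero]
  refine mul_left_cancel₀ h5 (h3.trans ?_)
  simp only [ContinuousLinearMap.comp_apply, smul_apply, innerSL_apply_apply,
    EuclideanSpace.inner_single_right, Complex.ofRealCLM_apply, smul_eq_mul, conj_trivial, one_mul,
    nsmul_eq_mul, Nat.cast_ofNat]
  rw [show -(Real.pi ^ 2 / t) * ‖ξ‖ ^ 2 = -(Real.pi * ‖ξ‖) ^ 2 / t by ring]
  push_cast
  linear_combination (-(2 * (Real.pi : ℂ) ^ 2 * ξ j / t * c *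
    Complex.exp (-(Real.pi * ‖ξ‖) ^ 2 / t))) * Complex.I_sq

/-- With `a = (d + 1)/2`, the Gamma integral `∫ t^(a-1) exp(-t r²) dt = Γ(a) r^(-2a)` produces the
power `|z|^(-(d+1))`. Its factor `Γ(a)` is the one in the normalising constant, which leaves only
`π^(-a)`. -/
theorem rieszKernel_eq_integral (z : V) :
    rieszKernel j z = Real.pi ^ (-(((d : ℝ) + 1) / 2)) *
      ∫ t in Set.Ioi (0 : ℝ), t ^ (((d : ℝ) + 1) / 2 - 1) * (z j * Real.exp (-t * ‖z‖ ^ 2)) := by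
  rcases eq_or_ne z 0 with rfl | hz
  · simp [rieszKernel]
  have hz0 : 0 < ‖z‖ := norm_pos_iff.2 hz
  have h := Real.integral_rpow_mul_exp_neg_mul_Ioi (a := ((d : ℝ) + 1) / 2) (r := ‖z‖ ^ 2)
    (by positivity) (by positivity)
  have h2 : (1 / ‖z‖ ^ 2) ^ (((d : ℝ) + 1) / 2) = 1 / ‖z‖ ^ (d + 1) := by
    rw [one_div, one_div, Real.inv_rpow (by positivity), ← Real.rpow_natCast ‖z‖ 2,
      ← Real.rpow_mul hz0.le, ← Real.rpow_natCast ‖z‖ (d + 1)]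
    congr 2
    push_cast
    ring
  rw [h2] at h
  have h3 : ∫ t in Set.Ioi (0 : ℝ), t ^ (((d : ℝ) + 1) / 2 - 1) *
      (z j * Real.exp (-t * ‖z‖ ^ 2)) =
      z j * ∫ t in Set.Ioi (0 : ℝ), t ^ (((d : ℝ) + 1) / 2 - 1) * Real.exp (-(‖z‖ ^ 2 * t)) := by
    rw [← integral_const_mul]
    congr 1 with t
    rw [show -t * ‖z‖ ^ 2 = -(‖z‖ ^ 2 * t) by ring]
    ring
  rw [h3, h, rieszKernel, Real.rpow_neg Real.pi_pos.le]
  ring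

/-- The substitution `u = 1/t` turns the integrand into `u^(-1/2) exp(-a² u)`. In the evaluation
below, `√π` is `Γ(1/2)`. -/
theorem integrableOn_rpow_neg_three_half_mul_exp {a : ℝ} (ha : 0 < a) :
    IntegrableOn (fun t : ℝ => t ^ (-(3 / 2) : ℝ) * Real.exp (-a ^ 2 / t)) (Set.Ioi 0) := by
  have h := (integrableOn_Ioi_comp_rpow_iff'
    (fun u : ℝ => u ^ (-(1 / 2) : ℝ) * Real.exp (-(a ^ 2) * u ^ (1 : ℝ))) (p := -1) (by norm_num)).2
    (integrableOn_rpow_mul_exp_neg_mul_rpow (by norm_num) one_pos (by positivity))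
  refine h.congr_fun (fun t ht => ?_) measurableSet_Ioi
  have ht0 : (0 : ℝ) < t := ht
  simp only [smul_eq_mul, Real.rpow_one]
  rw [← Real.rpow_mul ht0.le, ← mul_assoc, ← Real.rpow_add ht0, Real.rpow_neg_one]
  norm_num
  left
  ring

theorem integral_rpow_neg_three_half_mul_exp {a : ℝ} (ha : 0 < a) :
    ∫ t in Set.Ioi (0 : ℝ), t ^ (-(3 / 2) : ℝ) * Real.exp (-a ^ 2 / t) = √Real.pi / a := by
  have h := integral_comp_rpow_Ioi
    (fun u : ℝ => u ^ ((1 / 2 : ℝ) - 1) * Real.exp (-(a ^ 2 * u))) (p := -1) (by norm_num)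
  rw [Real.integral_rpow_mul_exp_neg_mul_Ioi (by norm_num) (by positivity),
    Real.Gamma_one_half_eq, ← Real.sqrt_eq_rpow, Real.sqrt_div zero_le_one, Real.sqrt_one,
    Real.sqrt_sq ha.le, one_div_mul_eq_div] at h
  rw [← h]
  refine setIntegral_congr_fun measurableSet_Ioi fun t ht => ?_
  have ht0 : (0 : ℝ) < t := ht
  simp only [smul_eq_mul, abs_neg, abs_one, one_mul]
  rw [← Real.rpow_mul ht0.le, ← mul_assoc, ← Real.rpow_add ht0, Real.rpow_neg_one]
  norm_num
  left
  ring

end SemiCommRiesz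

/-! ### The Fourier symbol of the Riesz transform. -/

namespace SemiCommRiesz
open scoped SchwartzMap FourierTransform RealInnerProductSpace

variable {d : ℕ} (j : Fin d)

local notation "V" => EuclideanSpace ℝ (Fin d)

/-- The integrand keeps the sign of `z j` for all `t`, so nothing is lost in taking absolute values.
Joint integrability in `(z, t)` thereby reduces to `integrable_rieszPV`. -/
theorem integral_norm_rieszKernel_representation (z : V) :
    ∫ t in Set.Ioi (0 : ℝ), ‖t ^ (((d : ℝ) + 1) / 2 - 1) * (z j * Real.exp (-t * ‖z‖ ^ 2))‖ =
      Real.pi ^ (((d : ℝ) + 1) / 2) * |rieszKernel j z| := by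
  have h : ∀ t ∈ Set.Ioi (0 : ℝ),
      ‖t ^ (((d : ℝ) + 1) / 2 - 1) * (z j * Real.exp (-t * ‖z‖ ^ 2))‖ =
      SignType.sign (z j) * (t ^ (((d : ℝ) + 1) / 2 - 1) * (z j * Real.exp (-t * ‖z‖ ^ 2))) := by
    intro t ht
    have ht0 : (0 : ℝ) < t := ht
    rw [norm_mul, norm_mul, Real.norm_of_nonneg (Real.exp_pos _).le,
      Real.norm_of_nonneg (by positivity), Real.norm_eq_abs, ← sign_mul_self]
    ring
  rw [setIntegral_congr_fun measurableSet_Ioi h, integral_const_mul]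
  have hK := rieszKernel_eq_integral j z
  set I := ∫ t in Set.Ioi (0 : ℝ), t ^ (((d : ℝ) + 1) / 2 - 1) * (z j * Real.exp (-t * ‖z‖ ^ 2))
  have hI : I = Real.pi ^ (((d : ℝ) + 1) / 2) * rieszKernel j z := by
    rw [hK, Real.rpow_neg Real.pi_pos.le, mul_inv_cancel_left₀]
    exact (Real.rpow_pos_of_pos Real.pi_pos _).ne'
  rw [hI, mul_left_comm]
  congr 1
  rw [← sign_mul_self (rieszKernel j z)]
  congr 2
  rcases eq_or_ne z 0 with rfl | hz
  · simp [rieszKernel]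
  have : 0 < ‖z‖ := norm_pos_iff.2 hz
  have hc := rieszConst_pos d
  rw [rieszKernel_eq, sign_mul, sign_pos hc, one_mul, div_eq_mul_inv, sign_mul,
    sign_pos (a := (‖z‖ ^ (d + 1))⁻¹) (by positivity), mul_one]

theorem integrableOn_rieszKernel_representation (z : V) :
    IntegrableOn (fun t : ℝ => t ^ (((d : ℝ) + 1) / 2 - 1) * (z j * Real.exp (-t * ‖z‖ ^ 2)))
      (Set.Ioi 0) := by
  rcases eq_or_ne z 0 with rfl | hz
  · simp
  have h0 : 0 < ‖z‖ := norm_pos_iff.2 hz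
  have hd : (0 : ℝ) < d := by exact_mod_cast j.pos
  refine IntegrableOn.congr_fun (Integrable.const_mul
    (integrableOn_rpow_mul_exp_neg_mul_rpow (s := ((d : ℝ) + 1) / 2 - 1) (p := 1)
    (b := ‖z‖ ^ 2) (by linarith) one_pos (by positivity)) (z j)) ?_ measurableSet_Ioi
  intro t _
  simp only [Real.rpow_one]
  rw [show -t * ‖z‖ ^ 2 = -‖z‖ ^ 2 * t by ring]
  ring

theorem measurable_rieszKernel_representation :
    Measurable fun q : V × ℝ =>
      q.2 ^ (((d : ℝ) + 1) / 2 - 1) * (q.1 j * Real.exp (-q.2 * ‖q.1‖ ^ 2)) := by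
  have : Measurable fun z : V => z j := (EuclideanSpace.proj (𝕜 := ℝ) j).continuous.measurable
  have h2 : Measurable fun q : V × ℝ => q.1 j := this.comp measurable_fst
  fun_prop

/-- The weight `z_j exp(-t|z|²)` is odd, so the two halves of the difference contribute equally; the
resulting `2` cancels the `1 / 2` in `rieszPV`. -/
theorem integral_gaussian_difference (f : 𝓢(V, ℂ)) (x : V) {t : ℝ} (ht : 0 < t) :
    ∫ z : V, ((z j * Real.exp (-t * ‖z‖ ^ 2) : ℝ) : ℂ) * (f (x - z) - f (x + z)) =
      2 * ∫ ξ, unitExp ⟪x, ξ⟫ * (𝓕 f) ξ *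
        (-Complex.I * ((Real.pi * ξ j / t * (Real.pi / t) ^ ((d : ℝ) / 2) *
          Real.exp (-(Real.pi * ‖ξ‖) ^ 2 / t) : ℝ) : ℂ)) := by
  have hk := integrable_coord_mul_gaussian j ht
  obtain ⟨B, hB⟩ : ∃ B, ∀ y, ‖f y‖ ≤ B := ⟨_, f.norm_le_seminorm ℝ⟩
  have i1 : Integrable fun z : V =>
      ((z j * Real.exp (-t * ‖z‖ ^ 2) : ℝ) : ℂ) * f (x - z) :=
    hk.mul_bdd (c := B) (f.continuous.comp (by fun_prop)).aestronglyMeasurable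
      (ae_of_all _ fun z => hB _)
  have i2 : Integrable fun z : V =>
      ((z j * Real.exp (-t * ‖z‖ ^ 2) : ℝ) : ℂ) * f (x + z) :=
    hk.mul_bdd (c := B) (f.continuous.comp (by fun_prop)).aestronglyMeasurable
      (ae_of_all _ fun z => hB _)
  have h2 : ∫ z : V, ((z j * Real.exp (-t * ‖z‖ ^ 2) : ℝ) : ℂ) * f (x + z) =
      -∫ z : V, ((z j * Real.exp (-t * ‖z‖ ^ 2) : ℝ) : ℂ) * f (x - z) := by
    rw [← integral_neg_eq_self, ← integral_neg]
    congr 1 with z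
    simp [sub_eq_add_neg]
  simp_rw [mul_sub]
  rw [integral_sub i1 i2, h2, sub_neg_eq_add, ← two_mul]
  have := integral_mul_schwartz_sub hk measurable_id f x
  simp only [id] at this
  rw [this]
  congr 2 with ξ
  rw [integral_coord_mul_gaussian_fourierChar j ht ξ]

/-- The integrand in the subordination formula for the multiplier of the Riesz transform. -/
def rieszSubordination (ξ : V) (t : ℝ) : ℝ :=
  Real.pi ^ ((d : ℝ) / 2 + 1) * ξ j *
    (t ^ (-(3 / 2) : ℝ) * Real.exp (-(Real.pi * ‖ξ‖) ^ 2 / t))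

/-- The dimension-dependent powers of `t` cancel, leaving `t^(-3/2)` in every dimension. -/
theorem rpow_mul_gaussian_fourier_eq {t : ℝ} (ht : 0 < t) (ξ : V) :
    t ^ (((d : ℝ) + 1) / 2 - 1) * (Real.pi * ξ j / t * (Real.pi / t) ^ ((d : ℝ) / 2) *
      Real.exp (-(Real.pi * ‖ξ‖) ^ 2 / t)) = rieszSubordination j ξ t := by
  have e1 : t ^ (((d : ℝ) + 1) / 2 - 1) = t ^ (-(3 / 2) : ℝ) * t * t ^ ((d : ℝ) / 2) := by
    rw [← Real.rpow_add_one ht.ne', ← Real.rpow_add ht]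
    congr 1
    ring
  have e2 : t ^ ((d : ℝ) / 2) ≠ 0 := (Real.rpow_pos_of_pos ht _).ne'
  rw [rieszSubordination, e1, Real.div_rpow Real.pi_pos.le ht.le,
    Real.rpow_add_one Real.pi_ne_zero]
  field_simp

theorem integral_rieszSubordination_base {ξ : V} (hξ : ξ ≠ 0) : Real.pi ^ ((d : ℝ) / 2 + 1) *
      ∫ t in Set.Ioi (0 : ℝ), t ^ (-(3 / 2) : ℝ) * Real.exp (-(Real.pi * ‖ξ‖) ^ 2 / t) =
        Real.pi ^ (((d : ℝ) + 1) / 2) / ‖ξ‖ := by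
  have h0 : 0 < ‖ξ‖ := norm_pos_iff.2 hξ
  rw [integral_rpow_neg_three_half_mul_exp (mul_pos Real.pi_pos h0),
    Real.sqrt_eq_rpow, Real.rpow_add_one Real.pi_ne_zero,
    show ((d : ℝ) + 1) / 2 = (d : ℝ) / 2 + 1 / 2 by ring, Real.rpow_add Real.pi_pos]
  field_simp

theorem integrable_rieszSubordination (ξ : V) :
    Integrable (rieszSubordination j ξ) (volume.restrict (Set.Ioi 0)) := by
  rcases eq_or_ne ξ 0 with rfl | hξ
  · have h : rieszSubordination j (0 : V) = 0 := by
      funext t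
      simp [rieszSubordination]
    rw [h]
    exact integrable_zero _ _ _
  have h0 : 0 < ‖ξ‖ := norm_pos_iff.2 hξ
  exact Integrable.const_mul
    (integrableOn_rpow_neg_three_half_mul_exp (mul_pos Real.pi_pos h0)) _

theorem integral_rieszSubordination (ξ : V) : ∫ t in Set.Ioi (0 : ℝ), rieszSubordination j ξ t =
    Real.pi ^ (((d : ℝ) + 1) / 2) * (ξ j / ‖ξ‖) := by
  rcases eq_or_ne ξ 0 with rfl | hξ
  · simp [rieszSubordination]
  simp only [rieszSubordination]
  rw [integral_const_mul, mul_right_comm, integral_rieszSubordination_base hξ]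
  ring

/-- Again the sign is constant in `t`. Since `|ξ j| ≤ ‖ξ‖`, the value is bounded uniformly in `ξ`,
which justifies Fubini on the frequency side. -/
theorem integral_norm_rieszSubordination (ξ : V) :
    ∫ t in Set.Ioi (0 : ℝ), ‖rieszSubordination j ξ t‖ =
      Real.pi ^ (((d : ℝ) + 1) / 2) * (|ξ j| / ‖ξ‖) := by
  rcases eq_or_ne ξ 0 with rfl | hξ
  · simp [rieszSubordination]
  have : ∀ t ∈ Set.Ioi (0 : ℝ), ‖rieszSubordination j ξ t‖ =
      Real.pi ^ ((d : ℝ) / 2 + 1) * |ξ j| *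
      (t ^ (-(3 / 2) : ℝ) * Real.exp (-(Real.pi * ‖ξ‖) ^ 2 / t)) := by
    intro t ht
    have ht0 : (0 : ℝ) < t := ht
    have hp := Real.pi_pos
    simp only [rieszSubordination]
    rw [norm_mul, norm_mul, Real.norm_eq_abs (ξ j), Real.norm_of_nonneg (by positivity),
      Real.norm_of_nonneg (by positivity)]
  rw [setIntegral_congr_fun measurableSet_Ioi this, integral_const_mul, mul_right_comm,
    integral_rieszSubordination_base hξ]
  ring

theorem measurable_rieszSubordination :
    Measurable fun q : V × ℝ => rieszSubordination j q.1 q.2 := by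
  have : Measurable fun z : V => z j := (EuclideanSpace.proj (𝕜 := ℝ) j).continuous.measurable
  have h2 : Measurable fun q : V × ℝ => q.1 j := this.comp measurable_fst
  unfold rieszSubordination
  fun_prop

theorem integrable_prod_mul_rieszSubordination {g : V → ℂ} (hg : Integrable g)
    (hgc : Continuous g) : Integrable (fun q : V × ℝ => g q.1 * (rieszSubordination j q.1 q.2 : ℂ))
      (volume.prod (volume.restrict (Set.Ioi 0))) := by
  have hmeas : Measurable fun q : V × ℝ => g q.1 * (rieszSubordination j q.1 q.2 : ℂ) :=
    (hgc.measurable.comp measurable_fst).mul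
      (Complex.measurable_ofReal.comp (measurable_rieszSubordination j))
  refine (integrable_prod_iff hmeas.aestronglyMeasurable).2 ⟨ae_of_all _ fun ξ => ?_, ?_⟩
  · have h0 : Integrable (fun t => (rieszSubordination j ξ t : ℂ))
      (volume.restrict (Set.Ioi 0)) := (integrable_rieszSubordination j ξ).ofReal
    exact h0.const_mul (g ξ)
  · simp only [norm_mul, Complex.norm_real]
    simp_rw [integral_const_mul, integral_norm_rieszSubordination]
    refine (hg.norm.mul_const (Real.pi ^ (((d : ℝ) + 1) / 2))).mono' ?_ (ae_of_all _ fun ξ => ?_)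
    · have : Measurable fun z : V => z j :=
        (EuclideanSpace.proj (𝕜 := ℝ) j).continuous.measurable
      have h2 := hgc.measurable
      exact Measurable.aestronglyMeasurable (by fun_prop)
    · have hp := Real.pi_pos
      rw [Real.norm_of_nonneg (by positivity)]
      refine mul_le_mul_of_nonneg_left ?_ (norm_nonneg _)
      refine mul_le_of_le_one_right (by positivity) ?_
      exact div_le_one_of_le₀ (PiLp.norm_apply_le ξ j) (norm_nonneg _)

/-- The `j`-th Riesz transform is the Fourier multiplier with symbol `-i ξ_j / |ξ|`. -/
theorem rieszPV_eq_integral_fourier (f : 𝓢(V, ℂ)) (x : V) :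
    rieszPV j f x = ∫ ξ, unitExp ⟪x, ξ⟫ * (𝓕 f) ξ * (-Complex.I * ((ξ j / ‖ξ‖ : ℝ) : ℂ)) := by
  set a : ℝ := ((d : ℝ) + 1) / 2 with ha
  set P : ℝ := Real.pi ^ (-a) with hP
  set Δ : V → ℂ := fun z => f (x - z) - f (x + z) with hΔ
  set κ : V → ℝ → ℝ := fun z t => t ^ (a - 1) * (z j * Real.exp (-t * ‖z‖ ^ 2)) with hκ
  have hΔm : Continuous Δ := by
    have := f.continuous
    fun_prop
  have hint1 : Integrable (fun q : V × ℝ => (κ q.1 q.2 : ℂ) * Δ q.1)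
      (volume.prod (volume.restrict (Set.Ioi 0))) := by
    have hmeas : Measurable fun q : V × ℝ => (κ q.1 q.2 : ℂ) * Δ q.1 :=
      (Complex.measurable_ofReal.comp (measurable_rieszKernel_representation j)).mul
        (hΔm.measurable.comp measurable_fst)
    refine (integrable_prod_iff hmeas.aestronglyMeasurable).2 ⟨ae_of_all _ fun z => ?_, ?_⟩
    · exact (Integrable.ofReal (𝕜 := ℂ)
        (integrableOn_rieszKernel_representation j z)).mul_const (Δ z)
    · have h := ((integrable_rieszPV j f x).norm).const_mul (Real.pi ^ a)
      refine h.congr (ae_of_all _ fun z => ?_)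
      simp only [norm_mul, Complex.norm_real]
      rw [integral_mul_const, Real.norm_eq_abs, ← mul_assoc,
        ← integral_norm_rieszKernel_representation]
  have hFc : Continuous fun ξ : V => unitExp ⟪x, ξ⟫ * (𝓕 f) ξ := by
    have := (𝓕 f).continuous
    fun_prop
  have hFi : Integrable fun ξ : V => unitExp ⟪x, ξ⟫ * (𝓕 f) ξ :=
    (𝓕 f).integrable.bdd_mul (c := 1)
      (Continuous.aestronglyMeasurable (by fun_prop)) (ae_of_all _ fun ξ => by simp)
  have hint2 := integrable_prod_mul_rieszSubordination j hFi hFc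
  have hPa : (P : ℂ) * ((Real.pi ^ a : ℝ) : ℂ) = 1 := by
    rw [← Complex.ofReal_mul, hP, ← Real.rpow_add Real.pi_pos]
    simp
  -- For fixed `t` the `z`-integral moves to the frequency side; the `t`-integral is done only after
  -- a second exchange of order.
  have hstep : ∀ t ∈ Set.Ioi (0 : ℝ), ∫ z, (κ z t : ℂ) * Δ z =
      (2 * -Complex.I) * ∫ ξ, unitExp ⟪x, ξ⟫ * (𝓕 f) ξ * (rieszSubordination j ξ t : ℂ) := by
    intro t ht
    have e : ∀ z, (κ z t : ℂ) * Δ z = ((t ^ (a - 1) : ℝ) : ℂ) *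
        (((z j * Real.exp (-t * ‖z‖ ^ 2) : ℝ) : ℂ) * (f (x - z) - f (x + z))) := by
      intro z
      simp only [hκ, hΔ]
      push_cast
      ring
    simp_rw [e]
    rw [integral_const_mul, integral_gaussian_difference j f x ht, ← integral_const_mul,
      ← integral_const_mul, ← integral_const_mul]
    refine integral_congr_ae (ae_of_all _ fun ξ => ?_)
    simp only
    rw [← rpow_mul_gaussian_fourier_eq j ht ξ]
    push_cast
    ring
  calc rieszPV j f x = (1 / 2 : ℂ) * ∫ z, (P : ℂ) *
        ∫ t in Set.Ioi (0 : ℝ), (κ z t : ℂ) * Δ z := by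
        rw [rieszPV]
        congr 2 with z
        rw [integral_mul_const, integral_complex_ofReal, rieszKernel_eq_integral]
        push_cast
        ring
    _ = (1 / 2 : ℂ) * P * ∫ t in Set.Ioi (0 : ℝ), ∫ z, (κ z t : ℂ) * Δ z := by
        rw [integral_const_mul, integral_integral_swap hint1, mul_assoc]
    _ = -Complex.I * P * ∫ t in Set.Ioi (0 : ℝ),
          ∫ ξ, unitExp ⟪x, ξ⟫ * (𝓕 f) ξ * (rieszSubordination j ξ t : ℂ) := by
        rw [setIntegral_congr_fun measurableSet_Ioi hstep, integral_const_mul]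
        ring
    _ = -Complex.I * P * ∫ ξ, unitExp ⟪x, ξ⟫ * (𝓕 f) ξ *
          ((Real.pi ^ a * (ξ j / ‖ξ‖) : ℝ) : ℂ) := by
        rw [← integral_integral_swap hint2]
        congr 2 with ξ
        rw [integral_const_mul, integral_complex_ofReal, integral_rieszSubordination]
    _ = _ := by
        rw [← integral_const_mul]
        congr 1 with ξ
        rw [Complex.ofReal_mul]
        linear_combination (-Complex.I * unitExp ⟪x, ξ⟫ * (𝓕 f) ξ * ((ξ j / ‖ξ‖ : ℝ) : ℂ)) * hPa

end SemiCommRiesz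

/-! ### Strong convergence of multipliers in `L_p`. -/

namespace SemiCommRiesz
open scoped SchwartzMap FourierTransform RealInnerProductSpace

/-- Uniform convergence to zero together with an `L_1` bound implies `L_p` convergence, `p > 1`. -/
theorem tendsto_eLpNorm_of_uniform_of_lintegral_le {α : Type*} [MeasurableSpace α] {μ : Measure α}
    {p : ℝ≥0∞} (hp : 1 < p) (hp' : p < ∞) {v : ℕ → α → ℂ} {a : ℕ → ℝ}
    (ha : Tendsto a atTop (𝓝 0)) (hva : ∀ n x, ‖v n x‖ ≤ a n) {C : ℝ≥0∞} (hC : C ≠ ∞)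
    (hL : ∀ n, ∫⁻ x, ‖v n x‖ₑ ∂μ ≤ C) :
    Tendsto (fun n => eLpNorm (v n) p μ) atTop (𝓝 0) := by
  set q := p.toReal with hq
  have hq1 : 1 < q := by
    rw [hq, ← ENNReal.toReal_one]
    exact (ENNReal.toReal_lt_toReal ENNReal.one_ne_top hp'.ne).2 hp
  have hq0 : 0 < q := zero_lt_one.trans hq1
  have hbound : ∀ n, eLpNorm (v n) p μ ≤
      (ENNReal.ofReal (a n) ^ (q - 1) * C) ^ (1 / q) := by
    intro n
    rw [eLpNorm_eq_lintegral_rpow_enorm_toReal (zero_lt_one.trans hp).ne' hp'.ne]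
    refine ENNReal.rpow_le_rpow ?_ (by positivity)
    calc ∫⁻ x, ‖v n x‖ₑ ^ q ∂μ
        ≤ ∫⁻ x, ENNReal.ofReal (a n) ^ (q - 1) * ‖v n x‖ₑ ∂μ := by
          refine lintegral_mono fun x => ?_
          have h1 : ‖v n x‖ₑ ^ q = ‖v n x‖ₑ ^ (q - 1) * ‖v n x‖ₑ := by
            conv_lhs => rw [← sub_add_cancel q 1]
            rw [ENNReal.rpow_add_of_nonneg _ _ (by linarith) zero_le_one, ENNReal.rpow_one]
          have h2 : ‖v n x‖ₑ ≤ ENNReal.ofReal (a n) := by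
            rw [← ofReal_norm]
            exact ENNReal.ofReal_le_ofReal (hva n x)
          simp only [h1]
          gcongr
      _ = ENNReal.ofReal (a n) ^ (q - 1) * ∫⁻ x, ‖v n x‖ₑ ∂μ :=
          lintegral_const_mul' _ _ (ENNReal.rpow_ne_top_of_nonneg (by linarith) ENNReal.ofReal_ne_top)
      _ ≤ _ := by gcongr; exact hL n
  have hlim : Tendsto (fun n => (ENNReal.ofReal (a n) ^ (q - 1) * C) ^ (1 / q)) atTop (𝓝 0) := by
    -- Here `p > 1` is essential: the sup bound enters with the exponent `q - 1 > 0`.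
    have h1 : Tendsto (fun n => ENNReal.ofReal (a n) ^ (q - 1)) atTop (𝓝 0) := by
      have := ((ENNReal.continuous_rpow_const (y := q - 1)).tendsto _).comp
        (ENNReal.tendsto_ofReal ha)
      simpa [Function.comp_def, ENNReal.zero_rpow_of_pos (sub_pos.2 hq1)] using this
    have h2 := ENNReal.Tendsto.mul_const h1 (Or.inr hC)
    rw [zero_mul] at h2
    have := ((ENNReal.continuous_rpow_const (y := 1 / q)).tendsto _).comp h2
    simpa [Function.comp_def, ENNReal.zero_rpow_of_pos (inv_pos.2 hq0)] using this
  exact tendsto_of_tendsto_of_tendsto_of_le_of_le tendsto_const_nhds hlim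
    (fun _ => zero_le) hbound

section Averages

variable {U W : Type*} [NormedAddCommGroup U] [InnerProductSpace ℝ U] [FiniteDimensional ℝ U]
  [MeasurableSpace U] [BorelSpace U] [MeasurableSpace W] {μ : Measure W}

/-- Multipliers `a_n` that are Fourier transforms of push-forwards of one integrable weight and
converge almost everywhere to a constant `c` converge to `c` strongly in `L_p`, `1 < p < ∞`. -/
theorem tendsto_eLpNorm_multiplier [SFinite μ] {k : W → ℂ} (hk : Integrable k μ)
    (hkm : Measurable k) {L : ℕ → W → U} (hL : ∀ n, Measurable (L n)) (φ : 𝓢(U, ℂ))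
    (g : ℕ → 𝓢(U, ℂ)) {a : ℕ → U → ℂ}
    (ha : ∀ n ξ, a n ξ = ∫ t, k t * unitExp (-⟪L n t, ξ⟫) ∂μ)
    (hg : ∀ n ξ, (𝓕 (g n)) ξ = a n ξ * (𝓕 φ) ξ) {c : ℂ}
    (hlim : ∀ᵐ ξ, Tendsto (fun n => a n ξ) atTop (𝓝 c)) {p : ℝ≥0∞} (hp : 1 < p) (hp' : p < ∞) :
    Tendsto (fun n => eLpNorm (fun x => g n x - c * φ x) p volume) atTop (𝓝 0) := by
  -- As averages of translates of `φ`, the `g n` have `L_1` norm at most `‖k‖₁ ‖φ‖₁`, whatever `L n`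
  -- is.
  have hgx : ∀ n x, g n x = ∫ t, k t * φ (x - L n t) ∂μ := by
    intro n x
    rw [integral_mul_schwartz_sub hk (hL n), schwartz_eq_integral_fourier]
    congr 1 with ξ
    rw [hg, ha]
    ring
  have hbd : ∀ n ξ, ‖a n ξ‖ ≤ ∫ t, ‖k t‖ ∂μ := by
    intro n ξ
    rw [ha]
    refine (norm_integral_le_integral_norm _).trans (le_of_eq ?_)
    simp
  refine tendsto_eLpNorm_of_uniform_of_lintegral_le hp hp'
    (a := fun n => ∫ ξ, ‖(𝓕 (g n)) ξ - c * (𝓕 φ) ξ‖)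
    (C := (∫⁻ t, ‖k t‖ₑ ∂μ) * (∫⁻ x, ‖φ x‖ₑ) + ‖c‖ₑ * ∫⁻ x, ‖φ x‖ₑ) ?_ ?_ ?_ ?_
  · have := tendsto_integral_of_dominated_convergence (μ := (volume : Measure U))
      (F := fun n ξ => ‖(𝓕 (g n)) ξ - c * (𝓕 φ) ξ‖) (f := fun _ => 0)
      (fun ξ => ((∫ t, ‖k t‖ ∂μ) + ‖c‖) * ‖(𝓕 φ) ξ‖) ?_ ((𝓕 φ).integrable.norm.const_mul _) ?_ ?_
    · simpa using this
    · intro n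
      have h1 := (𝓕 (g n)).continuous
      have h2 := (𝓕 φ).continuous
      exact Continuous.aestronglyMeasurable (by fun_prop)
    · intro n
      refine ae_of_all _ fun ξ => ?_
      rw [norm_norm, hg, ← sub_mul, norm_mul]
      gcongr
      exact (norm_sub_le _ _).trans (by gcongr; exact hbd n ξ)
    · filter_upwards [hlim] with ξ hξ
      have h := ((hξ.sub_const c).mul_const ((𝓕 φ) ξ)).norm
      simp only [sub_self, zero_mul, norm_zero] at h
      refine h.congr fun n => ?_
      rw [hg, sub_mul]
  · intro n x
    have h1 : g n x - c * φ x =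
        ∫ ξ, unitExp ⟪x, ξ⟫ * ((𝓕 (g n)) ξ - c * (𝓕 φ) ξ) := by
      have hi : ∀ ψ : 𝓢(U, ℂ), Integrable fun ξ => unitExp ⟪x, ξ⟫ * ψ ξ := fun ψ =>
        ψ.integrable.bdd_mul (c := 1) (Continuous.aestronglyMeasurable (by fun_prop))
          (ae_of_all _ fun ξ => by simp)
      rw [schwartz_eq_integral_fourier (g n), schwartz_eq_integral_fourier φ,
        ← integral_const_mul, ← integral_sub (hi _) ((hi _).const_mul c)]
      congr 1 with ξ
      ring
    rw [h1]
    refine (norm_integral_le_integral_norm _).trans (le_of_eq ?_)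
    simp
  · have h1 := hk.2.ne
    have h2 := (φ.integrable (μ := volume)).2.ne
    finiteness
  · intro n
    have hφm := φ.continuous.measurable
    have h1 : ∫⁻ x, ‖g n x‖ₑ ≤ (∫⁻ t, ‖k t‖ₑ ∂μ) * ∫⁻ x, ‖φ x‖ₑ := by
      calc ∫⁻ x, ‖g n x‖ₑ ≤ ∫⁻ x, (∫⁻ t, ‖k t‖ₑ * ‖φ (x - L n t)‖ₑ ∂μ) := by
            refine lintegral_mono fun x => ?_
            simp only [hgx n x]
            refine (enorm_integral_le_lintegral_enorm _).trans (le_of_eq ?_)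
            simp only [enorm_mul]
        _ = ∫⁻ t, (∫⁻ x, ‖k t‖ₑ * ‖φ (x - L n t)‖ₑ) ∂μ := by
            refine lintegral_lintegral_swap (Measurable.aemeasurable ?_)
            have h1 : Measurable fun q : U × W => q.1 - L n q.2 :=
              measurable_fst.sub ((hL n).comp measurable_snd)
            exact (hkm.comp measurable_snd).enorm.mul (hφm.comp h1).enorm
        _ = ∫⁻ t, ‖k t‖ₑ * (∫⁻ x, ‖φ x‖ₑ) ∂μ := by
            congr 1 with t
            rw [lintegral_const_mul' _ _ enorm_ne_top,
              lintegral_sub_right_eq_self (fun x => ‖φ x‖ₑ) (L n t)]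
        _ = _ := lintegral_mul_const _ hkm.enorm
    calc ∫⁻ x, ‖g n x - c * φ x‖ₑ ≤ ∫⁻ x, ‖g n x‖ₑ + ‖c‖ₑ * ‖φ x‖ₑ := by
          refine lintegral_mono fun x => ?_
          exact enorm_sub_le.trans (by rw [enorm_mul])
      _ = (∫⁻ x, ‖g n x‖ₑ) + ‖c‖ₑ * ∫⁻ x, ‖φ x‖ₑ := by
          rw [lintegral_add_left (g n).continuous.measurable.enorm,
            lintegral_const_mul' _ _ enorm_ne_top]
      _ ≤ _ := by gcongr

end Averages

end SemiCommRiesz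

/-! ### Frequency cut-offs and density in scalar `L_p`. -/

namespace SemiCommRiesz
open scoped SchwartzMap FourierTransform RealInnerProductSpace

section Bump

variable {U : Type*} [NormedAddCommGroup U] [InnerProductSpace ℝ U] [FiniteDimensional ℝ U]

/-- A smooth bump function equal to `1` on the unit ball and supported in the ball of radius `2`. -/
def unitBump (U : Type*) [NormedAddCommGroup U] : ContDiffBump (0 : U) :=
  ⟨1, 2, one_pos, one_lt_two⟩

theorem unitBump_eq_one {x : U} (hx : ‖x‖ ≤ 1) : unitBump U x = 1 :=
  (unitBump U).one_of_mem_closedBall (by simpa [unitBump] using hx)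

theorem unitBump_eq_zero {x : U} (hx : 2 ≤ ‖x‖) : unitBump U x = 0 :=
  (unitBump U).zero_of_le_dist (by simpa [unitBump] using hx)

/-- The bump function `unitBump` as a Schwartz function. -/
def schwartzBump (U : Type*) [NormedAddCommGroup U] [InnerProductSpace ℝ U]
    [FiniteDimensional ℝ U] : 𝓢(U, ℂ) :=
  HasCompactSupport.toSchwartzMap (f := fun x => (unitBump U x : ℂ))
    ((unitBump U).hasCompactSupport.comp_left Complex.ofReal_zero)
    (Complex.ofRealCLM.contDiff.comp (unitBump U).contDiff)

theorem schwartzBump_apply (x : U) : schwartzBump U x = (unitBump U x : ℂ) := rfl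

variable [MeasurableSpace U] [BorelSpace U]

theorem integral_fourierInv_mul_unitExp (φ : 𝓢(U, ℂ)) (ξ : U) :
    ∫ t, (𝓕⁻ φ) t * unitExp (-⟪t, ξ⟫) = φ ξ := by
  have h : 𝓕 (𝓕⁻ φ) = φ := FourierTransform.fourier_fourierInv_eq φ
  conv_rhs => rw [← h]
  rw [SchwartzMap.fourier_coe, Real.fourier_eq']
  congr 1 with t
  rw [smul_eq_mul, mul_comm, unitExp]
  congr 4
  ring

/-- Every smooth compactly supported function is the Fourier transform of a Schwartz function. -/
theorem exists_schwartz_fourier_eq {G : U → ℂ} (hG : HasCompactSupport G)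
    (hG' : ContDiff ℝ (⊤ : ℕ∞) G) :
    ∃ g : 𝓢(U, ℂ), ∀ ξ, (𝓕 g) ξ = G ξ := by
  refine ⟨𝓕⁻ (hG.toSchwartzMap hG'), fun ξ => ?_⟩
  have h : 𝓕 (𝓕⁻ (hG.toSchwartzMap hG')) = hG.toSchwartzMap hG' :=
    FourierTransform.fourier_fourierInv_eq _
  rw [h]
  rfl

theorem tendsto_toLp_of_eLpNorm {p : ℝ≥0∞} [Fact (1 ≤ p)] (g : ℕ → 𝓢(U, ℂ)) (φ : 𝓢(U, ℂ))
    (h : Tendsto (fun n => eLpNorm (fun x => g n x - φ x) p volume) atTop (𝓝 0)) :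
    Tendsto (fun n => (g n).toLp p volume) atTop (𝓝 (φ.toLp p volume)) :=
  (Lp.tendsto_Lp_iff_tendsto_eLpNorm'' (fun n => ⇑(g n)) (fun n => (g n).memLp p volume) φ
    (φ.memLp p volume)).2 h

/-- Band-limited Schwartz functions are dense in `L_p`. -/
theorem dense_toLp_hasCompactSupport_fourier {p : ℝ≥0∞} [Fact (1 ≤ p)] (hp : 1 < p) (hp' : p < ∞) :
    Dense {u : Lp ℂ p (volume : Measure U) |
      ∃ φ : 𝓢(U, ℂ), HasCompactSupport (𝓕 φ : 𝓢(U, ℂ)) ∧ u = φ.toLp p volume} := by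
  refine Dense.of_closure ((SchwartzMap.denseRange_toLpCLM (E := U) (F := ℂ) (p := p)
    (μ := volume) hp'.ne).mono ?_)
  rintro _ ⟨φ, rfl⟩
  set a : ℕ → U → ℂ := fun n ξ => schwartzBump U ((1 / ((n : ℝ) + 1)) • ξ) with ha
  have hsupp : ∀ n, HasCompactSupport (a n) := fun n =>
    ((unitBump U).hasCompactSupport.comp_left Complex.ofReal_zero).comp_smul
      (by positivity : 1 / ((n : ℝ) + 1) ≠ 0)
  have hsmooth : ∀ n, ContDiff ℝ (⊤ : ℕ∞) (a n) := fun n =>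
    ((schwartzBump U).smooth ⊤).comp (contDiff_id.const_smul _)
  have hG : ∀ n, ∃ g : 𝓢(U, ℂ), ∀ ξ, (𝓕 g) ξ = a n ξ * (𝓕 φ) ξ := fun n =>
    exists_schwartz_fourier_eq (hsupp n).mul_right ((hsmooth n).mul ((𝓕 φ).smooth ⊤))
  choose g hg using hG
  have hlim : ∀ ξ, Tendsto (fun n => a n ξ) atTop (𝓝 1) := by
    intro ξ
    have h1 : Tendsto (fun n : ℕ => (1 / ((n : ℝ) + 1)) • ξ) atTop (𝓝 0) := by
      simpa using (tendsto_one_div_add_atTop_nhds_zero_nat (𝕜 := ℝ)).smul_const ξ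
    have h2 := ((schwartzBump U).continuous.tendsto 0).comp h1
    rwa [schwartzBump_apply, unitBump_eq_one (by simp), Complex.ofReal_one] at h2
  -- Dilating the bump in frequency amounts to pushing the fixed weight `𝓕⁻ (schwartzBump U)`
  -- forward under `t ↦ t/(n+1)`.
  have h := tendsto_eLpNorm_multiplier (μ := volume) (k := ⇑(𝓕⁻ (schwartzBump U) : 𝓢(U, ℂ)))
    (SchwartzMap.integrable _) (SchwartzMap.continuous _).measurable
    (L := fun n t => (1 / ((n : ℝ) + 1)) • t) (fun n => measurable_const_smul _) φ g (a := a)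
    (fun n ξ => by
      simp only [ha]
      rw [← integral_fourierInv_mul_unitExp]
      simp_rw [real_inner_smul_left, real_inner_smul_right]) hg
    (ae_of_all _ hlim) hp hp'
  simp only [one_mul] at h
  refine mem_closure_of_tendsto (tendsto_toLp_of_eLpNorm g φ h) (Eventually.of_forall fun n => ?_)
  refine ⟨g n, ?_, rfl⟩
  have : ((𝓕 (g n) : 𝓢(U, ℂ)) : U → ℂ) = fun ξ => a n ξ * (𝓕 φ) ξ := funext (hg n)
  rw [this]
  exact (hsupp n).mul_right

end Bump

variable {d : ℕ} (j : Fin d)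

local notation "V" => EuclideanSpace ℝ (Fin d)

theorem ae_coord_ne_zero : ∀ᵐ ξ : V, ξ j ≠ 0 := by
  have h := Measure.addHaar_submodule (volume : Measure V)
    (LinearMap.ker (EuclideanSpace.proj (𝕜 := ℝ) j : V →L[ℝ] ℝ).toLinearMap) (by
      intro h
      have : EuclideanSpace.single j (1 : ℝ) ∈
        LinearMap.ker (EuclideanSpace.proj (𝕜 := ℝ) j : V →L[ℝ] ℝ).toLinearMap := by
        rw [h]; trivial
      simp at this)
  rw [ae_iff]
  convert h using 2
  ext ξ
  simp

/-- Near `ξ_j = 0`, which contains the origin, the factor `1 - unitBump` vanishes identically and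
hides the singularities of both `1/ξ_j` and `‖ξ‖`. Elsewhere every factor is smooth. -/
theorem contDiff_riesz_symbol_mul (n : ℕ) (ψ : 𝓢(V, ℂ)) :
    ContDiff ℝ (⊤ : ℕ∞) fun ξ : V => (‖ξ‖ / ξ j * (1 - unitBump ℝ (n * ξ j))) • ψ ξ := by
  have hcoord : ContDiff ℝ (⊤ : ℕ∞) fun ξ : V => ξ j := (EuclideanSpace.proj (𝕜 := ℝ) j).contDiff
  rw [contDiff_iff_contDiffAt]
  intro ξ
  by_cases hξ : ξ j = 0
  · have hev : ∀ᶠ η : V in 𝓝 ξ, ‖(n : ℝ) * η j‖ < 1 := by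
      have hc : Continuous fun η : V => ‖(n : ℝ) * η j‖ := by
        have := hcoord.continuous
        fun_prop
      refine hc.continuousAt.eventually_lt continuousAt_const ?_
      simp [hξ]
    refine (contDiffAt_const (c := (0 : ℂ))).congr_of_eventuallyEq ?_
    filter_upwards [hev] with η hη
    rw [unitBump_eq_one hη.le]
    simp
  · have hξ0 : ξ ≠ 0 := by
      rintro rfl
      simp at hξ
    refine ContDiffAt.smul (𝕜 := ℝ) (𝕜' := ℝ) ?_ (ψ.smooth ⊤).contDiffAt
    refine ((contDiffAt_norm ℝ hξ0).div hcoord.contDiffAt hξ).mul (contDiffAt_const.sub ?_)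
    exact ((unitBump ℝ).contDiff.comp (contDiff_const.mul hcoord)).contDiffAt

/-- The factor `i ‖ξ‖ / ξ_j` inverts the symbol `-i ξ_j / ‖ξ‖`, so this provides the preimage under
the Riesz transform. -/
theorem exists_schwartz_riesz_symbol_mul (n : ℕ) (ψ : 𝓢(V, ℂ)) (hψ : HasCompactSupport ψ) :
    ∃ f : 𝓢(V, ℂ), ∀ ξ, (𝓕 f) ξ =
      Complex.I * ((‖ξ‖ / ξ j * (1 - unitBump ℝ (n * ξ j))) • ψ ξ) := by
  refine exists_schwartz_fourier_eq (HasCompactSupport.intro' hψ (isClosed_tsupport ψ) ?_)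
    (contDiff_const.mul (contDiff_riesz_symbol_mul j n ψ))
  intro ξ hξ
  rw [image_eq_zero_of_notMem_tsupport hξ, smul_zero, mul_zero]

/-- Frequency cut-offs to shrinking neighbourhoods of a hyperplane tend to zero in `L_p`. -/
theorem exists_tendsto_eLpNorm_hyperplane_cutoff (φ : 𝓢(V, ℂ))
    (hφ : HasCompactSupport (𝓕 φ : 𝓢(V, ℂ))) {p : ℝ≥0∞} (hp : 1 < p) (hp' : p < ∞) :
    ∃ u : ℕ → 𝓢(V, ℂ), (∀ (n : ℕ) ξ, (𝓕 (u n)) ξ = (unitBump ℝ (n * ξ j) : ℂ) * (𝓕 φ) ξ) ∧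
      Tendsto (fun n => eLpNorm (u n) p volume) atTop (𝓝 0) := by
  set a : ℕ → V → ℂ := fun n ξ => schwartzBump ℝ (n * ξ j) with ha
  have hcoord : ContDiff ℝ (⊤ : ℕ∞) fun ξ : V => ξ j :=
    (EuclideanSpace.proj (𝕜 := ℝ) j).contDiff
  have hu : ∀ n, ∃ u : 𝓢(V, ℂ), ∀ ξ, (𝓕 u) ξ = a n ξ * (𝓕 φ) ξ := fun n =>
    exists_schwartz_fourier_eq hφ.mul_left
      ((((schwartzBump ℝ).smooth ⊤).comp (contDiff_const.mul hcoord)).mul ((𝓕 φ).smooth ⊤))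
  choose u hu using hu
  have hlim : ∀ᵐ ξ, Tendsto (fun n => a n ξ) atTop (𝓝 0) := by
    filter_upwards [ae_coord_ne_zero j] with ξ hξ
    have h1 : Tendsto (fun n : ℕ => (n : ℝ) * |ξ j|) atTop atTop :=
      tendsto_natCast_atTop_atTop.atTop_mul_const (abs_pos.2 hξ)
    refine tendsto_const_nhds.congr' ?_
    filter_upwards [h1.eventually_ge_atTop 2] with n hn
    simp only [ha]
    rw [schwartzBump_apply, unitBump_eq_zero, Complex.ofReal_zero]
    rwa [norm_mul, Real.norm_natCast, Real.norm_eq_abs]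
  -- The cut-off depends on `ξ_j` alone, so the averages run over translations along the line
  -- spanned by `e_j`: the weight lives on `ℝ` rather than on the whole space.
  have h := tendsto_eLpNorm_multiplier (μ := volume) (k := ⇑(𝓕⁻ (schwartzBump ℝ) : 𝓢(ℝ, ℂ)))
    (SchwartzMap.integrable _) (SchwartzMap.continuous _).measurable
    (L := fun (n : ℕ) (t : ℝ) => ((n : ℝ) * t) • (EuclideanSpace.single j (1 : ℝ) : V))
    (fun n => Continuous.measurable (by fun_prop)) φ u (a := a)
    (fun n ξ => by
      simp only [ha]
      rw [← integral_fourierInv_mul_unitExp]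
      congr 1 with t
      rw [real_inner_smul_left, EuclideanSpace.inner_single_left]
      congr 3
      simp
      ring) hu hlim hp hp'
  simp only [zero_mul, sub_zero] at h
  exact ⟨u, hu, h⟩

/-- A band-limited Schwartz function minus its frequency cut-off to a neighbourhood of `ξ_j = 0` is
the Riesz transform of a Schwartz function. -/
theorem exists_rieszPV_eq_sub (φ u : 𝓢(V, ℂ)) (hφ : HasCompactSupport (𝓕 φ : 𝓢(V, ℂ))) (n : ℕ)
    (hu : ∀ ξ, (𝓕 u) ξ = (unitBump ℝ (n * ξ j) : ℂ) * (𝓕 φ) ξ) :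
    ∃ f : 𝓢(V, ℂ), ∀ x, rieszPV j f x = (φ - u) x := by
  obtain ⟨f, hf⟩ : ∃ f : 𝓢(V, ℂ), ∀ ξ, (𝓕 f) ξ =
      Complex.I * ((‖ξ‖ / ξ j * (1 - unitBump ℝ (n * ξ j))) • (𝓕 φ) ξ) :=
    exists_schwartz_riesz_symbol_mul j n (𝓕 φ) hφ
  have hF : ∀ ξ, (𝓕 f) ξ * (-Complex.I * ((ξ j / ‖ξ‖ : ℝ) : ℂ)) = (𝓕 (φ - u)) ξ := by
    intro ξ
    have hsub : (𝓕 (φ - u)) ξ = (𝓕 φ) ξ - (𝓕 u) ξ := by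
      rw [← SchwartzMap.fourierTransformCLM_apply ℂ (φ - u), map_sub]
      rfl
    rw [hsub, hf, hu, Complex.real_smul]
    -- On the hyperplane the cut-off equals 1, so both sides vanish and the default value of
    -- division by zero does no harm.
    by_cases hξ : ξ j = 0
    · rw [hξ, mul_zero, unitBump_eq_one (by simp)]
      simp
    · have hξ0 : ‖ξ‖ ≠ 0 := by
        rw [norm_ne_zero_iff]
        rintro rfl
        simp at hξ
      have e1 : (ξ j : ℂ) ≠ 0 := by exact_mod_cast hξ
      have e2 : (‖ξ‖ : ℂ) ≠ 0 := by exact_mod_cast hξ0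
      push_cast
      field_simp
      linear_combination (-(1 - (unitBump ℝ (n * ξ j) : ℂ)) * (𝓕 φ) ξ) * Complex.I_sq
  refine ⟨f, fun x => ?_⟩
  rw [rieszPV_eq_integral_fourier, schwartz_eq_integral_fourier (φ - u)]
  congr 1 with ξ
  rw [mul_assoc, hF]

/-- Schwartz functions that are Riesz transforms of Schwartz functions are dense in `L_p`. -/
theorem dense_toLp_rieszPV {p : ℝ≥0∞} [Fact (1 ≤ p)] (hp : 1 < p) (hp' : p < ∞) :
    Dense {u : Lp ℂ p (volume : Measure V) | ∃ f g : 𝓢(V, ℂ),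
      (∀ x, rieszPV j f x = g x) ∧ u = g.toLp p volume} := by
  refine Dense.of_closure ((dense_toLp_hasCompactSupport_fourier hp hp').mono ?_)
  rintro _ ⟨φ, hφ, rfl⟩
  obtain ⟨u, hu, hlim⟩ := exists_tendsto_eLpNorm_hyperplane_cutoff j φ hφ hp hp'
  refine mem_closure_of_tendsto (tendsto_toLp_of_eLpNorm (fun n => φ - u n) φ
    (hlim.congr fun n => ?_)) (Eventually.of_forall fun n => ?_)
  · rw [← eLpNorm_neg]
    congr 1 with x
    simp
  · obtain ⟨f, hf⟩ := exists_rieszPV_eq_sub j φ (u n) hφ n (hu n)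
    exact ⟨f, φ - u n, hf, rfl⟩

end SemiCommRiesz

/-! ### Vector-valued truncations and the range of the Riesz transform. -/

namespace SemiCommRiesz
open scoped SchwartzMap

variable {d : ℕ} {E : Type*} [NormedAddCommGroup E] [NormedSpace ℂ E] (j : Fin d)

local notation "V" => EuclideanSpace ℝ (Fin d)

theorem integrableOn_rieszKernel_smul {ε : ℝ} (hε : 0 < ε) {f : V → E} (hf : Integrable f) (x : V) :
    IntegrableOn (fun y => ((rieszKernel j (x - y) : ℝ) : ℂ) • f y) {y | ε < ‖x - y‖} := by
  have hms : MeasurableSet {y : V | ε < ‖x - y‖} :=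
    measurableSet_lt measurable_const (by fun_prop)
  have hc := rieszConst_pos d
  refine Integrable.bdd_smul (f := f) hf.integrableOn (rieszConst d * (ε ^ d)⁻¹) ?_ ?_
  · exact (Complex.measurable_ofReal.comp ((measurable_rieszKernel j).comp
      (measurable_const.sub measurable_id))).aestronglyMeasurable
  · refine (ae_restrict_iff' hms).2 (ae_of_all _ fun y hy => ?_)
    simp only [Complex.norm_real, Real.norm_eq_abs]
    refine (abs_rieszKernel_le j _).trans ?_
    have : ε < ‖x - y‖ := hy
    gcongr

theorem truncRiesz_congr_ae {f g : V → E} (h : f =ᵐ[volume] g) (ε : ℝ) (x : V) :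
    truncRiesz j ε f x = truncRiesz j ε g x := by
  refine integral_congr_ae (ae_restrict_of_ae ?_)
  filter_upwards [h] with y hy
  rw [hy]

theorem truncRiesz_add {f g : V → E} (hf : Integrable f) (hg : Integrable g) {ε : ℝ} (hε : 0 < ε)
    (x : V) : truncRiesz j ε (f + g) x = truncRiesz j ε f x + truncRiesz j ε g x := by
  unfold truncRiesz
  rw [← integral_add (integrableOn_rieszKernel_smul j hε hf x)
    (integrableOn_rieszKernel_smul j hε hg x)]
  simp_rw [Pi.add_apply, smul_add]

theorem truncRiesz_const_smul (c : ℂ) (f : V → E) (ε : ℝ) (x : V) :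
    truncRiesz j ε (c • f) x = c • truncRiesz j ε f x := by
  unfold truncRiesz
  rw [← integral_smul]
  simp_rw [Pi.smul_apply, smul_comm c]

/-- Needed for Minkowski's inequality in `add_mem'` below; it follows from joint measurability of
the truncated integrand. -/
theorem aestronglyMeasurable_truncRiesz {f : V → E} (hf : AEStronglyMeasurable f volume) (ε : ℝ) :
    AEStronglyMeasurable (truncRiesz j ε f) volume := by
  have h : AEStronglyMeasurable (fun q : V × V =>
      Set.indicator {y | ε < ‖q.1 - y‖} (fun y => ((rieszKernel j (q.1 - y) : ℝ) : ℂ) • f y) q.2)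
      (volume.prod volume) := by
    have hs : MeasurableSet {q : V × V | ε < ‖q.1 - q.2‖} :=
      measurableSet_lt measurable_const (by fun_prop)
    have h1 : AEStronglyMeasurable (fun q : V × V =>
        ((rieszKernel j (q.1 - q.2) : ℝ) : ℂ) • f q.2) (volume.prod volume) :=
      (Complex.measurable_ofReal.comp ((measurable_rieszKernel j).comp
        (measurable_fst.sub measurable_snd))).aestronglyMeasurable.smul hf.comp_snd
    exact h1.indicator hs
  refine h.integral_prod_right'.congr (ae_of_all _ fun x => ?_)
  exact integral_indicator (measurableSet_lt measurable_const (by fun_prop))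

/-- The `L_p` functions that are Riesz transforms of integrable functions in `L_p`. -/
def rieszRangeIntegrable (E : Type*) [NormedAddCommGroup E] [NormedSpace ℂ E] (p : ℝ≥0∞)
    [Fact (1 ≤ p)] (j : Fin d) : Submodule ℂ (Lp E p (volume : Measure V)) where
  carrier := {g | ∃ f : Lp E p (volume : Measure V), Integrable f ∧ IsRieszTransform j f g}
  zero_mem' := by
    have h0 : (((0 : Lp E p (volume : Measure V)) : V → E)) =ᵐ[volume] 0 := Lp.coeFn_zero E p volume
    refine ⟨0, (integrable_zero V E volume).congr h0.symm, ?_⟩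
    refine tendsto_const_nhds.congr fun ε => ?_
    symm
    rw [eLpNorm_congr_ae (g := 0), eLpNorm_zero]
    filter_upwards [h0] with x hx
    rw [hx, truncRiesz_congr_ae j h0]
    simp [truncRiesz]
  add_mem' := by
    rintro g₁ g₂ ⟨f₁, hf₁, h₁⟩ ⟨f₂, hf₂, h₂⟩
    have hfa := Lp.coeFn_add f₁ f₂
    have hga := Lp.coeFn_add g₁ g₂
    refine ⟨f₁ + f₂, (hf₁.add hf₂).congr hfa.symm, ?_⟩
    have hlim := h₁.add h₂
    rw [add_zero] at hlim
    refine tendsto_of_tendsto_of_tendsto_of_le_of_le' tendsto_const_nhds hlim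
      (Eventually.of_forall fun _ => zero_le) ?_
    filter_upwards [self_mem_nhdsWithin] with ε hε
    have hm : ∀ f g : Lp E p (volume : Measure V),
        AEStronglyMeasurable (fun x => truncRiesz j ε f x - g x) volume := fun f g =>
      (aestronglyMeasurable_truncRiesz j (Lp.aestronglyMeasurable f) ε).sub
        (Lp.aestronglyMeasurable g)
    refine le_trans (le_of_eq (eLpNorm_congr_ae ?_))
      (eLpNorm_add_le (hm f₁ g₁) (hm f₂ g₂) (Fact.out : 1 ≤ p))
    filter_upwards [hga] with x hx
    -- Integrability of `f₁` and `f₂` makes both truncated integrals converge absolutely and hence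
    -- add; this is why it is built into the submodule.
    rw [hx, truncRiesz_congr_ae j hfa, truncRiesz_add j hf₁ hf₂ hε]
    simp only [Pi.add_apply]
    abel
  smul_mem' := by
    rintro c g ⟨f, hf, h⟩
    have hfa := Lp.coeFn_smul c f
    have hga := Lp.coeFn_smul c g
    refine ⟨c • f, (hf.smul c).congr hfa.symm, ?_⟩
    have hlim := ENNReal.Tendsto.const_mul (a := ‖c‖ₑ) h (Or.inr enorm_ne_top)
    rw [mul_zero] at hlim
    refine hlim.congr fun ε => ?_
    rw [← eLpNorm_const_smul]
    refine eLpNorm_congr_ae ?_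
    filter_upwards [hga] with x hx
    rw [hx, truncRiesz_congr_ae j hfa, truncRiesz_const_smul]
    simp [smul_sub]

theorem rieszRangeIntegrable_subset (p : ℝ≥0∞) [Fact (1 ≤ p)] :
    (rieszRangeIntegrable E p j : Set (Lp E p (volume : Measure V))) ⊆ rieszRange E p j :=
  fun _ ⟨f, _, h⟩ => ⟨f, h⟩

theorem truncRiesz_smul_const [CompleteSpace E] (f : V → ℂ) (m : E) (ε : ℝ) (x : V) :
    truncRiesz j ε (fun y => f y • m) x = truncRiesz j ε f x • m := by
  unfold truncRiesz
  rw [← integral_smul_const]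
  simp_rw [smul_assoc]

/-- If the Schwartz function `g` is the Riesz transform of the Schwartz function `f`, then `g ⊗ m`
is the Riesz transform of `f ⊗ m`. -/
theorem compLp_mem_rieszRangeIntegrable [CompleteSpace E] {p : ℝ≥0∞} [Fact (1 ≤ p)]
    {f g : 𝓢(V, ℂ)} (h : ∀ x, rieszPV j f x = g x) (m : E) :
    (ContinuousLinearMap.toSpanSingleton ℂ m).compLp (g.toLp p volume) ∈
      rieszRangeIntegrable E p j := by
  have key : ∀ φ : 𝓢(V, ℂ), (ContinuousLinearMap.toSpanSingleton ℂ m).compLp (φ.toLp p volume)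
      =ᵐ[volume] fun x => φ x • m := by
    intro φ
    filter_upwards [(ContinuousLinearMap.toSpanSingleton ℂ m).coeFn_compLp (φ.toLp p volume),
      φ.coeFn_toLp p volume] with x h1 h2
    rw [h1, h2, ContinuousLinearMap.toSpanSingleton_apply]
  refine ⟨(ContinuousLinearMap.toSpanSingleton ℂ m).compLp (f.toLp p volume),
    (f.integrable.smul_const m).congr (key f).symm, ?_⟩
  have hlim := ENNReal.Tendsto.mul_const (b := ‖m‖ₑ) (tendsto_eLpNorm_truncRiesz j f p)
    (Or.inr enorm_ne_top)
  rw [zero_mul] at hlim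
  refine tendsto_of_tendsto_of_tendsto_of_le_of_le tendsto_const_nhds hlim
    (fun _ => zero_le) fun ε => ?_
  have e : eLpNorm (fun x => truncRiesz j ε
      ((ContinuousLinearMap.toSpanSingleton ℂ m).compLp (f.toLp p volume)) x -
      (ContinuousLinearMap.toSpanSingleton ℂ m).compLp (g.toLp p volume) x) p volume =
      eLpNorm (fun x => (truncRiesz j ε f x - rieszPV j f x) • m) p volume := by
    refine eLpNorm_congr_ae ?_
    filter_upwards [key g] with x hx
    rw [hx, truncRiesz_congr_ae j (key f), truncRiesz_smul_const, h, sub_smul]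
  simp only [e]
  have := eLpNorm_le_mul_eLpNorm_of_ae_le_mul (μ := (volume : Measure V)) (c := ‖m‖)
    (f := fun x => (truncRiesz j ε f x - rieszPV j f x) • m)
    (g := fun x => truncRiesz j ε f x - rieszPV j f x)
    (ae_of_all _ fun x => by rw [norm_smul, mul_comm]) p
  rwa [ofReal_norm, mul_comm] at this

theorem denseRange_toNCLp {H : Type*} [NormedAddCommGroup H] [InnerProductSpace ℂ H]
    [CompleteSpace H] {M : VonNeumannAlgebra H} (τ : NSFTrace M) (p : ℝ≥0∞) :
    DenseRange (toNCLp τ p) :=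
  UniformSpace.Completion.denseRange_coe (α := FinSuppLp τ p)

end SemiCommRiesz

end

/-! ### Conclusion for `L_p(M)`-valued functions. -/

theorem lemma3p3 {H : Type*} [NormedAddCommGroup H] [InnerProductSpace ℂ H] [CompleteSpace H]
    (M : VonNeumannAlgebra H) (τ : SemiCommRiesz.NSFTrace M)
    (d : ℕ) (j : Fin d) (p : ℝ≥0∞) [Fact (1 ≤ p)] (hp : 1 < p) (hp' : p < ∞) :
    Dense (SemiCommRiesz.rieszRange (SemiCommRiesz.NCLp τ p) p j ∩
      (SemiCommRiesz.schwartzTensor d τ p : Set (SemiCommRiesz.SemiLp d τ p))) ∧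
    Dense (SemiCommRiesz.rieszRange (SemiCommRiesz.NCLp τ p) p j :
      Set (SemiCommRiesz.SemiLp d τ p)) := by
  suffices h : Dense (SemiCommRiesz.rieszRange (SemiCommRiesz.NCLp τ p) p j ∩
      (SemiCommRiesz.schwartzTensor d τ p : Set (SemiCommRiesz.SemiLp d τ p))) from
    ⟨h, h.mono Set.inter_subset_left⟩
  -- The dense span of the `g ⊗ m`, with `g` a Schwartz Riesz transform of a Schwartz function and
  -- `m ∈ 𝒮(M)`, lies in both sets. Inclusion in the range needs only the generators, because the
  -- Riesz transforms of integrable functions form a subspace.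
  refine (dense_span_toSpanSingleton_compLp hp'.ne (SemiCommRiesz.dense_toLp_rieszPV j hp hp')
    (SemiCommRiesz.denseRange_toNCLp τ p)).mono (Set.subset_inter ?_ ?_)
  · refine Set.Subset.trans ?_ (SemiCommRiesz.rieszRangeIntegrable_subset j p)
    refine Submodule.span_le.2 ?_
    rintro _ ⟨_, ⟨f, g, h, rfl⟩, m, _, rfl⟩
    exact SemiCommRiesz.compLp_mem_rieszRangeIntegrable j h m
  · refine Submodule.span_le.2 ?_
    rintro _ ⟨_, ⟨f, g, h, rfl⟩, _, ⟨m, rfl⟩, rfl⟩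
    refine Submodule.subset_span ⟨g, m, ?_⟩
    filter_upwards [(ContinuousLinearMap.toSpanSingleton ℂ
      (SemiCommRiesz.toNCLp τ p m)).coeFn_compLp (g.toLp p volume),
      g.coeFn_toLp p volume] with x h1 h2
    rw [h1, h2, ContinuousLinearMap.toSpanSingleton_apply]
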